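/- Let $G$ be a compact (Hausdorff) topological group and let $\mathcal H$ be a stable $G$-Hilbert space, i.e. a complex Hilbert space with a strongly continuous unitary representation $g \mapsto g$ of $G$ in which every irreducible representation of $G$ occurs with infinite multiplicity. Let $U(\mathcal H)$ be the unitary group of $\mathcal H$ with the norm topology, and let $$U_{G\text{-cts}}(\mathcal H)=\{u\in U(\mathcal H) : \text{the map } G\to U(\mathcal H),\ g\mapsto g u g^{-1}, \text{ is norm continuous}\},$$ a subgroup of $U(\mathcal H)$ on which $G$ acts continuously by conjugation. Then $U_{G\text{-cts}}(\mathcal H)$ is equivariantly contractible: there are a $G$-fixed point $u_0\in U_{G\text{-cts}}(\mathcal H)$ and a norm-continuous map $F:[0,1]\times U_{G\text{-cts}}(\mathcal H)\to U_{G\text{-cts}}(\mathcal H)$ with $F(0,u)=u$, $F(1,u)=u_0$ and $F(t,gug^{-1})=g\,F(t,u)\,g^{-1}$ for all $g\in G$, $t\in[0,1]$ and $u\in U_{G\text{-cts}}(\mathcal H)$. -/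

import Mathlib

/-- A (complex) `G`-Hilbert space structure on `H`: a unitary representation of the topological
group `G` on the Hilbert space `H` that is continuous for the strong operator topology. The image
of `π` consists of unitary operators, so this is the same as joint continuity of the action map
`G × H → H`; norm continuity of `g ↦ π g` is not required. -/
structure GHilbertStructure (G : Type*) [Group G] [TopologicalSpace G]
    (H : Type*) [NormedAddCommGroup H] [InnerProductSpace ℂ H] [CompleteSpace H] where
  /-- the homomorphism into the unitary group of `H` -/
  hom : G →* unitary (H →L[ℂ] H)
  /-- strong continuity -/
  continuous_apply : ∀ ξ : H, Continuous fun g : G => (hom g : H →L[ℂ] H) ξ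

namespace GHilbertStructure

section

variable {G : Type*} [Group G] [TopologicalSpace G]
  {H : Type*} [NormedAddCommGroup H] [InnerProductSpace ℂ H] [CompleteSpace H]

/-- The underlying linear representation. -/
noncomputable def toRepresentation (π : GHilbertStructure G H) : Representation ℂ G H where
  toFun g := ((π.hom g : H →L[ℂ] H) : H →ₗ[ℂ] H)
  map_one' := by ext; simp
  map_mul' g h := by ext; simp

/-- A `G`-Hilbert space is stable if each irreducible representation of `G` occurs in it with
infinite multiplicity: for each irreducible continuous representation `σ` the space of
intertwining operators from `σ` to `H` is infinite dimensional. As `G` is compact, all its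
irreducible representations are finite dimensional, so up to isomorphism they live on some `ℂⁿ`;
linear maps out of `ℂⁿ` are automatically continuous. -/
def IsStable (π : GHilbertStructure G H) : Prop :=
  ∀ (n : ℕ) (σ : Representation ℂ G (Fin n → ℂ)),
    (∀ v : Fin n → ℂ, Continuous fun g : G => σ g v) → σ.IsIrreducible →
      ¬ Module.Finite ℂ (Representation.IntertwiningMap σ π.toRepresentation)

/-- The group of `G`-continuous unitary operators: those unitary `u` for which
`g ↦ g u g⁻¹` is continuous for the norm topology. As a subspace of `H →L[ℂ] H` it carries the
norm topology. -/
noncomputable def unitaryGCts (π : GHilbertStructure G H) : Subgroup (unitary (H →L[ℂ] H)) where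
  carrier := {u | Continuous fun g : G => π.hom g * u * (π.hom g)⁻¹}
  one_mem' := by simpa using continuous_const
  mul_mem' {u v} hu hv := by
    have h : Continuous fun g : G =>
        (π.hom g * u * (π.hom g)⁻¹) * (π.hom g * v * (π.hom g)⁻¹) := Continuous.mul hu hv
    simpa [mul_assoc] using h
  inv_mem' {u} hu := by
    have h : Continuous fun g : G => (π.hom g * u * (π.hom g)⁻¹)⁻¹ := Continuous.inv hu
    simpa [mul_assoc] using h

theorem mem_unitaryGCts {π : GHilbertStructure G H} {u : unitary (H →L[ℂ] H)} :
    u ∈ π.unitaryGCts ↔ Continuous fun g : G => π.hom g * u * (π.hom g)⁻¹ := Iff.rfl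

variable [IsTopologicalGroup G]

/-- `G` acts on the `G`-continuous unitary operators by conjugation, `g • u = g u g⁻¹`. -/
noncomputable instance instSMulUnitaryGCts (π : GHilbertStructure G H) :
    SMul G π.unitaryGCts where
  smul g u := ⟨π.hom g * (u : unitary (H →L[ℂ] H)) * (π.hom g)⁻¹, by
    have h : Continuous fun k : G =>
        π.hom (k * g) * (u : unitary (H →L[ℂ] H)) * (π.hom (k * g))⁻¹ :=
      (mem_unitaryGCts.1 u.2).comp (continuous_mul_const g)
    rw [mem_unitaryGCts]
    simpa [mul_assoc] using h⟩

theorem coe_smul_unitaryGCts (π : GHilbertStructure G H) (g : G) (u : π.unitaryGCts) :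
    (g • u).1 = π.hom g * (u : unitary (H →L[ℂ] H)) * (π.hom g)⁻¹ := rfl

/-- The conjugation action satisfies the axioms of a group action. -/
noncomputable instance instMulActionUnitaryGCts (π : GHilbertStructure G H) :
    MulAction G π.unitaryGCts where
  one_smul u := Subtype.ext (by
    rw [coe_smul_unitaryGCts, map_one, one_mul, inv_one, mul_one])
  mul_smul g h u := Subtype.ext (by
    rw [coe_smul_unitaryGCts, coe_smul_unitaryGCts, coe_smul_unitaryGCts, map_mul, mul_inv_rev]
    simp only [mul_assoc])

/-- The conjugation action of `G` on the `G`-continuous unitary operators with the norm topology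
is jointly continuous, so that they form a `G`-space. -/
instance instContinuousSMulUnitaryGCts (π : GHilbertStructure G H) :
    ContinuousSMul G π.unitaryGCts where
  continuous_smul := by
    have hdist : ∀ (g : G) (u v : π.unitaryGCts), dist (g • u) (g • v) = dist u v := by
      intro g u v
      simp only [Subtype.dist_eq, coe_smul_unitaryGCts, dist_eq_norm, Submonoid.coe_mul]
      rw [← sub_mul, ← mul_sub, CStarRing.norm_mul_coe_unitary, CStarRing.norm_coe_unitary_mul]
    rw [continuous_iff_continuousAt]
    rintro ⟨g₀, u₀⟩
    rw [ContinuousAt, tendsto_iff_dist_tendsto_zero]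
    have h1 : Filter.Tendsto (fun p : G × π.unitaryGCts => dist p.2 u₀ + dist (p.1 • u₀) (g₀ • u₀))
        (nhds (g₀, u₀)) (nhds 0) := by
      have hc : Continuous fun g : G => g • u₀ :=
        Continuous.subtype_mk (mem_unitaryGCts.1 u₀.2) _
      have : Continuous fun p : G × π.unitaryGCts =>
          dist p.2 u₀ + dist (p.1 • u₀) (g₀ • u₀) :=
        (continuous_snd.dist continuous_const).add
          ((hc.comp continuous_fst).dist continuous_const)
      simpa using this.tendsto (g₀, u₀)
    refine squeeze_zero (fun _ => dist_nonneg) (fun p => ?_) h1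
    calc dist (p.1 • p.2) (g₀ • u₀) ≤ dist (p.1 • p.2) (p.1 • u₀) + dist (p.1 • u₀) (g₀ • u₀) :=
          dist_triangle _ _ _
      _ = _ := by rw [hdist]

end

end GHilbertStructure

/-- A `G`-space `X` is equivariantly contractible if its identity map is homotopic, through
`G`-equivariant maps, to the constant map at a `G`-fixed point of `X`. -/
def EquivariantlyContractible (G X : Type*) [Group G] [TopologicalSpace G] [TopologicalSpace X]
    [MulAction G X] [ContinuousSMul G X] : Prop :=
  ∃ x₀ : X, (∀ g : G, g • x₀ = x₀) ∧
    ∃ F : (ContinuousMap.id X).Homotopy (ContinuousMap.const X x₀),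
      ∀ (g : G) (t : unitInterval) (x : X), F (t, g • x) = g • F (t, x)

/-! This is an equivariant form of Kuiper's theorem, proved universally. Consider the ring of
norm-continuous equivariant functions from the space of `G`-continuous unitaries to the bounded
operators on `H`. The inclusion `tautological π` is a unit of this ring, and it is enough to join it
to `1` by a path of units. The unitary factor of the polar decomposition turns such a path into a
unitary one, and equivariance turns continuity in the point into `G`-continuity of the values.

The units that can be joined to `1` form a normal subgroup containing all quarter turns and all `1 -
n` with `n * n = 0` (`equivariantMaps.containsElementary`). For such a subgroup the rest is algebra
(`ContainsElementary.mem_of_swindle`). Let `S`, `T` be orthogonal copies of the whole module inside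
itself, and let a unit map `S` into the kernel of the projection to `T`. Two rotations make the unit
fix `S`, a shear splits off the complement, and the remaining block is absorbed by an Eilenberg
swindle inside `S`, which contains infinitely many copies of everything. An error of norm at most
`1/2` in the condition on `S` and `T` is harmless, since a linear path of units removes it
(`equivariantMaps.mem_deformable_of_almost_orthogonal`).

It remains to find continuous invariant families `S x`, `T x` of intertwining isometries with `star
(T x) * x * S x` small (`exists_almost_orthogonal_sections`). By compactness of `G` and stability,
`H` is an orthogonal sum of finite dimensional irreducibles, each repeated countably often
(`IsStable.exists_decomposition`). For finitely many operators, Kuiper's lemma `exists_thin_family`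
finds new copies of all summands that these operators move in mutually orthogonal directions. The
copies span only a part of density zero, so there is room to repeat the choice for larger finite
sets of operators. A `G`-invariant partition of unity whose members meet only along chains of finite
sets (`exists_invariant_nested_partition`) glues these choices. -/

section UnitaryRepresentations

open MeasureTheory InnerProductSpace
open scoped InnerProductSpace

namespace GHilbertStructure

/-! ### Existence of finite dimensional irreducible subspaces. -/

section Representations

variable {G : Type*} [Group G] [TopologicalSpace G]
  {H : Type*} [NormedAddCommGroup H] [InnerProductSpace ℂ H] [CompleteSpace H]
  (π : GHilbertStructure G H)

/-- The operator by which a group element acts. -/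
noncomputable abbrev op (g : G) : H →L[ℂ] H := (π.hom g : H →L[ℂ] H)

@[simp] theorem op_one : π.op 1 = 1 := by simp [op]

theorem op_mul (g h : G) : π.op (g * h) = π.op g * π.op h := by simp [op]

theorem op_mul_apply (g h : G) (v : H) : π.op (g * h) v = π.op g (π.op h v) := by simp [op]

@[simp] theorem op_apply_op_inv (g : G) (v : H) : π.op g (π.op g⁻¹ v) = v := by
  rw [← op_mul_apply, mul_inv_cancel, op_one]; rfl

theorem inner_op_op (g : G) (v w : H) : ⟪π.op g v, π.op g w⟫_ℂ = ⟪v, w⟫_ℂ :=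
  (π.op g).inner_map_map_of_mem_unitary (π.hom g).2 v w

theorem inner_op_left (g : G) (v w : H) : ⟪π.op g v, w⟫_ℂ = ⟪v, π.op g⁻¹ w⟫_ℂ := by
  rw [← π.inner_op_op g v, op_apply_op_inv]

/-- A subspace is invariant if it is mapped into itself by the group. -/
def IsInvariant (M : Submodule ℂ H) : Prop := ∀ g, ∀ v ∈ M, π.op g v ∈ M

/-- A finite dimensional irreducible subrepresentation. -/
structure IsIrreducibleSubspace (K : Submodule ℂ H) : Prop where
  invariant : π.IsInvariant K
  finiteDimensional : FiniteDimensional ℂ K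
  ne_bot : K ≠ ⊥
  eq_of_le : ∀ K' ≤ K, π.IsInvariant K' → K' ≠ ⊥ → K' = K

/-- A nonzero finite dimensional invariant subspace contains an irreducible one. -/
theorem exists_irreducible_le_of_finiteDimensional {M : Submodule ℂ H} (hM : π.IsInvariant M)
    [FiniteDimensional ℂ M] (h0 : M ≠ ⊥) : ∃ K ≤ M, π.IsIrreducibleSubspace K := by
  classical
  let P : ℕ → Prop := fun d => ∃ K ≤ M, π.IsInvariant K ∧ K ≠ ⊥ ∧ Module.finrank ℂ K = d
  have hP : ∃ d, P d := ⟨_, M, le_rfl, hM, h0, rfl⟩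
  obtain ⟨K, hKM, hK, hK0, hd⟩ := Nat.find_spec hP
  have hfin : FiniteDimensional ℂ K := Submodule.finiteDimensional_of_le hKM
  refine ⟨K, hKM, hK, hfin, hK0, fun K' hK' hi hne => ?_⟩
  refine Submodule.eq_of_le_of_finrank_le hK' ?_
  rw [hd]
  exact Nat.find_min' hP ⟨K', hK'.trans hKM, hi, hne, rfl⟩

variable [IsTopologicalGroup G] [CompactSpace G]

/-- The average of the rank one operators `η ⊗ η` over the orbit of `η`. -/
theorem exists_compact_invariant_operator {M : Submodule ℂ H} (hM : π.IsInvariant M)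
    (hc : IsClosed (M : Set H)) {η : H} (hη : η ∈ M) (h0 : η ≠ 0) :
    ∃ T : H →L[ℂ] H, IsCompactOperator T ∧ T.IsSymmetric ∧ T ≠ 0 ∧ (∀ v, T v ∈ M) ∧
      ∀ g v, T (π.op g v) = π.op g (T v) := by
  borelize G
  let μ : Measure G := Measure.haarMeasure ⊤
  have hμ : IsProbabilityMeasure μ := ⟨by
    have := Measure.haarMeasure_self (K₀ := (⊤ : TopologicalSpace.PositiveCompacts G))
    simpa using this⟩
  let f : G → H →L[ℂ] H := fun g => rankOne ℂ (π.op g η) (π.op g η)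
  -- Strong continuity is enough for norm continuity here, because a rank one operator depends
  -- norm-continuously on its vector.
  have hf : Continuous f := by
    have h1 : Continuous fun g => π.op g η := π.continuous_apply η
    exact (((ContinuousLinearMap.smulRightL ℂ H H).continuous.comp
      ((innerSL ℂ).continuous.comp h1)).clm_apply h1)
  have hfi : Integrable f μ := hf.integrable_of_hasCompactSupport (.of_compactSpace f)
  have happ : ∀ v, (∫ g, f g ∂μ) v = ∫ g, f g v ∂μ := fun v =>
    ContinuousLinearMap.integral_apply hfi v
  have hfv : ∀ v, Integrable (fun g => f g v) μ := fun v =>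
    Continuous.integrable_of_hasCompactSupport (by fun_prop) (.of_compactSpace _)
  have hfapp : ∀ g v, f g v = ⟪π.op g η, v⟫_ℂ • π.op g η := fun g v => by
    simp [f, rankOne_apply]
  refine ⟨∫ g, f g ∂μ, ?_, ?_, ?_, ?_, ?_⟩
  -- Compact operators form a norm-closed convex set, so an average of rank one operators stays in
  -- it.
  · have hcl : IsClosed {A : H →L[ℂ] H | IsCompactOperator A} :=
      isClosed_setOfPred_isCompactOperator
    have hconv : Convex ℝ {A : H →L[ℂ] H | IsCompactOperator A} := by
      intro A hA B hB a b _ _ _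
      exact IsCompactOperator.add (f := ⇑(a • A)) (g := ⇑(b • B)) (hA.smul a) (hB.smul b)
    refine hconv.integral_mem hcl (Filter.Eventually.of_forall fun g => ?_) hfi
    have h1 : IsCompactOperator (ContinuousLinearMap.toSpanSingleton ℂ (π.op g η)) :=
      isCompactOperator_of_locallyCompactSpace_rng _
    exact h1.comp_clm (innerSL ℂ (π.op g η))
  · intro v w
    change ⟪(∫ g, f g ∂μ) v, w⟫_ℂ = ⟪v, (∫ g, f g ∂μ) w⟫_ℂ
    rw [happ, happ, ← integral_inner (hfv w), ← inner_conj_symm, ← integral_inner (hfv v),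
      ← integral_conj]
    refine integral_congr_ae (Filter.Eventually.of_forall fun g => ?_)
    simp [hfapp, inner_smul_right, mul_comm]
  · intro hz
    -- The diagonal coefficient at `η` is the integral of `‖⟪π.op g η, η⟫‖ ^ 2`, which is positive
    -- at `g = 1`.
    have h1 : ⟪η, (∫ g, f g ∂μ) η⟫_ℂ = 0 := by rw [hz]; simp
    rw [happ, ← integral_inner (hfv η)] at h1
    have h2 : ∀ g, ⟪η, f g η⟫_ℂ = ((‖⟪π.op g η, η⟫_ℂ‖ ^ 2 : ℝ) : ℂ) := fun g => by
      rw [hfapp, inner_smul_right, ← inner_conj_symm η, Complex.mul_conj, Complex.normSq_eq_norm_sq]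
    simp_rw [h2] at h1
    rw [integral_complex_ofReal, Complex.ofReal_eq_zero] at h1
    have hcont : Continuous fun g => ‖⟪π.op g η, η⟫_ℂ‖ ^ 2 := by
      have h1 : Continuous fun g => π.op g η := π.continuous_apply η
      fun_prop
    have h3 := hcont.integral_pos_of_hasCompactSupport_nonneg_nonzero (μ := μ)
      (.of_compactSpace _) (fun g => by positivity) (x := 1) (by simpa using h0)
    exact h3.ne' h1
  · intro v
    rw [happ]
    have hconv : Convex ℝ (M : Set H) := (M.restrictScalars ℝ).convex
    refine hconv.integral_mem hc (Filter.Eventually.of_forall fun g => ?_) (hfv v)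
    rw [hfapp]
    exact M.smul_mem _ (hM g η hη)
  · intro g v
    rw [happ, happ, ← ContinuousLinearMap.integral_comp_comm _ (hfv v),
      ← integral_mul_left_eq_self _ g]
    refine integral_congr_ae (Filter.Eventually.of_forall fun k => ?_)
    simp only [hfapp, op_mul_apply, inner_op_op, map_smul]

/-- Every nonzero closed invariant subspace contains a finite dimensional irreducible one. -/
theorem exists_irreducible_le {M : Submodule ℂ H} (hM : π.IsInvariant M)
    (hc : IsClosed (M : Set H)) (h0 : M ≠ ⊥) : ∃ K ≤ M, π.IsIrreducibleSubspace K := by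
  obtain ⟨η, hη, hη0⟩ := Submodule.exists_mem_ne_zero_of_ne_bot h0
  obtain ⟨T, hT, hs, hT0, hTM, hTπ⟩ := π.exists_compact_invariant_operator hM hc hη hη0
  -- By the spectral theorem there is a nonzero eigenvalue. Its eigenspace is finite dimensional by
  -- compactness, invariant because `T` intertwines, and contained in `M` because `T` maps into `M`.
  have h1 := mt (ContinuousLinearMap.eq_zero_of_forall_hasEigenvalue_eq_zero hT hs).1 hT0
  push Not at h1
  obtain ⟨μ, hμ, hμ0⟩ := h1
  have := ContinuousLinearMap.finite_dimensional_eigenspace hT μ hμ0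
  let E := Module.End.eigenspace (T : Module.End ℂ H) μ
  have hE : ∀ v, v ∈ E ↔ T v = μ • v := fun v => Module.End.mem_eigenspace_iff
  have hEM : E ≤ M := by
    intro v hv
    rw [hE] at hv
    have : v = μ⁻¹ • T v := by rw [hv, smul_smul, inv_mul_cancel₀ hμ0, one_smul]
    rw [this]
    exact M.smul_mem _ (hTM v)
  have hEi : π.IsInvariant E := by
    intro g v hv
    rw [hE] at hv ⊢
    rw [hTπ, hv, map_smul]
  obtain ⟨K, hK, hK'⟩ := π.exists_irreducible_le_of_finiteDimensional hEi hμ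
  exact ⟨K, hK.trans hEM, hK'⟩

end Representations

end GHilbertStructure

/-- If all fibres of `f` are infinite, then `α × ℕ ≃ α` over `f`. -/
theorem exists_prod_nat_equiv_of_infinite_fibers {α β : Type*} (f : α → β)
    (hf : ∀ a, Infinite {x // f x = f a}) :
    ∃ e : α × ℕ ≃ α, ∀ a n, f (e (a, n)) = f a := by
  have h : ∀ b, Nonempty ({x // f x = b} × ℕ ≃ {x // f x = b}) := by
    intro b
    rcases isEmpty_or_nonempty {x // f x = b} with h | ⟨a, rfl⟩
    · exact ⟨Equiv.equivOfIsEmpty _ _⟩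
    · have := hf a
      -- An infinite cardinal is unchanged by multiplication with `ℵ₀`.
      rw [← Cardinal.eq]
      simp
  choose e he using fun b => (⟨(h b).some, trivial⟩ : ∃ _ : ({x // f x = b} × ℕ ≃ {x // f x = b}), True)
  refine ⟨⟨fun p => e (f p.1) (⟨p.1, rfl⟩, p.2),
    fun a => (((e (f a)).symm ⟨a, rfl⟩).1.1, ((e (f a)).symm ⟨a, rfl⟩).2), ?_, ?_⟩, ?_⟩
  · rintro ⟨a, n⟩
    have key : ∀ b (x : {x // f x = b}) (hb : f a = b), x = e b (⟨a, hb⟩, n) →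
        (e (f x.1)).symm ⟨x.1, rfl⟩ = (⟨a, by rw [x.2, hb]⟩, n) := by
      rintro b ⟨x, hx⟩ hb h
      subst hx
      simp [h]
    have := key _ (e (f a) (⟨a, rfl⟩, n)) rfl rfl
    simp [this]
  · intro a
    have key : ∀ b (x : {x // f x = b} × ℕ) (hb : f a = b), e b x = ⟨a, hb⟩ →
        (e (f x.1.1) (⟨x.1.1, rfl⟩, x.2)).1 = a := by
      rintro b ⟨⟨x, hx⟩, n⟩ hb h
      subst hx
      simp [h]
    exact key _ ((e (f a)).symm ⟨a, rfl⟩) rfl (by simp)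
  · intro a n
    exact (e (f a) (⟨a, rfl⟩, n)).2

namespace GHilbertStructure

/-! ### Schur's lemma, complete reducibility and infinite multiplicities. -/

section Decomposition

variable {G : Type*} [Group G] [TopologicalSpace G]
  {H : Type*} [NormedAddCommGroup H] [InnerProductSpace ℂ H] [CompleteSpace H]
  (π : GHilbertStructure G H)

/-- A linear map between subspaces that commutes with the group action. -/
def IsEquivariantMap {K K' : Submodule ℂ H} (T : K → K') : Prop :=
  ∀ g (v w : K), (w : H) = π.op g v → (T w : H) = π.op g (T v)

/-- Unitary equivalence of subrepresentations. -/
def UnitarilyEquivalent (K K' : Submodule ℂ H) : Prop :=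
  ∃ φ : K ≃ₗᵢ[ℂ] K', π.IsEquivariantMap φ

variable {π}

theorem UnitarilyEquivalent.refl (K : Submodule ℂ H) : π.UnitarilyEquivalent K K :=
  ⟨.refl _ _, fun _ _ _ h => h⟩

theorem UnitarilyEquivalent.symm {K K' : Submodule ℂ H} (hK : π.IsInvariant K)
    (h : π.UnitarilyEquivalent K K') : π.UnitarilyEquivalent K' K := by
  obtain ⟨φ, hφ⟩ := h
  refine ⟨φ.symm, fun g v w hw => ?_⟩
  have h1 := hφ g (φ.symm v) ⟨_, hK g _ (φ.symm v).2⟩ rfl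
  rw [LinearIsometryEquiv.apply_symm_apply, ← hw] at h1
  have h2 := Subtype.ext h1
  rw [← h2, LinearIsometryEquiv.symm_apply_apply]

theorem UnitarilyEquivalent.trans {K K' K'' : Submodule ℂ H}
    (h : π.UnitarilyEquivalent K K') (h' : π.UnitarilyEquivalent K' K'') :
    π.UnitarilyEquivalent K K'' := by
  obtain ⟨φ, hφ⟩ := h
  obtain ⟨ψ, hψ⟩ := h'
  exact ⟨φ.trans ψ, fun g v w hw => hψ g (φ v) (φ w) (hφ g v w hw)⟩

/-- The kernel of an equivariant map on an irreducible subspace, Schur's lemma. -/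
theorem IsIrreducibleSubspace.injective {K K' : Submodule ℂ H} (hK : π.IsIrreducibleSubspace K)
    {T : K →ₗ[ℂ] K'} (hT : π.IsEquivariantMap T) (h0 : T ≠ 0) : Function.Injective T := by
  rw [← LinearMap.ker_eq_bot]
  by_contra hne
  apply h0
  have h1 := hK.eq_of_le ((LinearMap.ker T).map K.subtype) (Submodule.map_subtype_le _ _) (by
    rintro g _ ⟨v, hv, rfl⟩
    refine ⟨⟨_, hK.invariant g _ v.2⟩, ?_, rfl⟩
    have h2 := hT g v ⟨_, hK.invariant g _ v.2⟩ rfl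
    have hv' : T v = 0 := hv
    rw [hv', Submodule.coe_zero, map_zero] at h2
    exact Subtype.ext h2) (by
    rwa [ne_eq, ← Submodule.map_bot K.subtype,
      (Submodule.map_injective_of_injective K.injective_subtype).eq_iff])
  ext v
  have : (v : H) ∈ (LinearMap.ker T).map K.subtype := h1.symm ▸ v.2
  obtain ⟨w, hw, hwv⟩ := this
  have hwv' : w = v := Subtype.ext hwv
  have : T v = 0 := hwv' ▸ hw
  simp [this]

theorem IsIrreducibleSubspace.surjective {K K' : Submodule ℂ H} (hK : π.IsInvariant K)
    (hK' : π.IsIrreducibleSubspace K')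
    {T : K →ₗ[ℂ] K'} (hT : π.IsEquivariantMap T) (h0 : T ≠ 0) : Function.Surjective T := by
  have h1 := hK'.eq_of_le ((LinearMap.range T).map K'.subtype) (Submodule.map_subtype_le _ _) (by
    rintro g _ ⟨_, ⟨v, rfl⟩, rfl⟩
    exact ⟨_, ⟨⟨_, hK g _ v.2⟩, rfl⟩, hT g v ⟨_, hK g _ v.2⟩ rfl⟩) (by
    rw [ne_eq, ← Submodule.map_bot K'.subtype,
      (Submodule.map_injective_of_injective K'.injective_subtype).eq_iff, LinearMap.range_eq_bot]
    exact h0)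
  intro v
  have : (v : H) ∈ (LinearMap.range T).map K'.subtype := h1.symm ▸ v.2
  obtain ⟨_, ⟨w, rfl⟩, hwv⟩ := this
  exact ⟨w, Subtype.ext hwv⟩

/-- A nonzero equivariant map between irreducible subspaces is a multiple of a unitary one. -/
theorem IsIrreducibleSubspace.unitarilyEquivalent {K K' : Submodule ℂ H}
    (hK : π.IsIrreducibleSubspace K) (hK' : π.IsIrreducibleSubspace K')
    {T : K →ₗ[ℂ] K'} (hT : π.IsEquivariantMap T) (h0 : T ≠ 0) : π.UnitarilyEquivalent K K' := by
  have := hK.finiteDimensional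
  have := hK'.finiteDimensional
  have hnt : Nontrivial K := Submodule.nontrivial_iff_ne_bot.2 hK.ne_bot
  have hinj := hK.injective hT h0
  have hsurj := hK'.surjective hK.invariant hT h0
  -- `T* T` commutes with the group, so by Schur's lemma it is a scalar; dividing `T` by the square
  -- root of this scalar gives an isometry.
  let B : K →ₗ[ℂ] K := LinearMap.adjoint T ∘ₗ T
  have hB : ∀ v w, ⟪v, B w⟫_ℂ = ⟪T v, T w⟫_ℂ := fun v w => by
    simp [B, LinearMap.adjoint_inner_right]
  obtain ⟨μ, hμ⟩ := Module.End.exists_eigenvalue B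
  have hBeq : π.IsEquivariantMap B := by
    intro g v w hw
    let w' : K := ⟨π.op g (B v), hK.invariant g _ (B v).2⟩
    suffices h : B w = w' by rw [h]
    refine ext_inner_left ℂ fun x => ?_
    let y : K := ⟨π.op g⁻¹ x, hK.invariant _ _ x.2⟩
    have h1 : ⟪x, w'⟫_ℂ = ⟪y, B v⟫_ℂ := by
      rw [Submodule.coe_inner, Submodule.coe_inner]
      change ⟪(x : H), π.op g (B v)⟫_ℂ = ⟪π.op g⁻¹ x, _⟫_ℂ
      rw [inner_op_left, inv_inv]
    have h2 : (T w : H) = π.op g (T v) := hT g v w hw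
    have h3 : (T y : H) = π.op g⁻¹ (T x) := hT g⁻¹ x y rfl
    rw [h1, hB, hB, Submodule.coe_inner, Submodule.coe_inner, h2, h3, inner_op_left, inv_inv]
  have hBμ : ∀ v, B v = μ • v := by
    have h1 := hK.injective (T := B - μ • LinearMap.id) (fun g v w hw => by
      have := hBeq g v w hw
      simp [this, hw])
    by_contra! hne
    obtain ⟨v, hv⟩ := hne
    have h2 := h1 (fun h => hv (by
      have := LinearMap.congr_fun h v
      simpa [sub_eq_zero] using this))
    obtain ⟨x, hx, hx0⟩ := hμ.exists_hasEigenvector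
    refine hx0 (h2 ?_)
    rw [Module.End.mem_eigenspace_iff] at hx
    simp [hx]
  have hn : ∀ v, ‖T v‖ ^ 2 = μ.re * ‖v‖ ^ 2 := by
    intro v
    have h1 := hB v v
    rw [hBμ, inner_smul_right, inner_self_eq_norm_sq_to_K, inner_self_eq_norm_sq_to_K] at h1
    have h2 := congrArg Complex.re h1
    change (μ * ((‖v‖ : ℝ) : ℂ) ^ 2).re = (((‖T v‖ : ℝ) : ℂ) ^ 2).re at h2
    rw [← Complex.ofReal_pow, ← Complex.ofReal_pow, Complex.re_mul_ofReal, Complex.ofReal_re] at h2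
    exact h2.symm
  obtain ⟨x, hx⟩ := exists_ne (0 : K)
  have hpos : 0 < μ.re := by
    have h1 : 0 < ‖T x‖ ^ 2 := by
      have : T x ≠ 0 := fun h => hx (hinj (by simpa using h))
      positivity
    rw [hn] at h1
    exact (mul_pos_iff_of_pos_right (by positivity)).1 h1
  let c : ℝ := (Real.sqrt μ.re)⁻¹
  let φ : K →ₗᵢ[ℂ] K' := ⟨(c : ℂ) • T, fun v => by
    have hc : 0 ≤ c := by positivity
    rw [LinearMap.smul_apply, norm_smul, Complex.norm_real, Real.norm_of_nonneg hc,
      ← Real.sqrt_sq (norm_nonneg (T v)), hn, Real.sqrt_mul hpos.le, Real.sqrt_sq (norm_nonneg v),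
      inv_mul_cancel_left₀ (Real.sqrt_pos.2 hpos).ne']⟩
  have hφ : ∀ v, φ v = (c : ℂ) • T v := fun v => rfl
  have hc : (c : ℂ) ≠ 0 := by
    have : 0 < c := inv_pos.2 (Real.sqrt_pos.2 hpos)
    exact_mod_cast this.ne'
  refine ⟨LinearIsometryEquiv.ofSurjective φ fun v => ?_, fun g v w hw => ?_⟩
  · obtain ⟨w, rfl⟩ := hsurj v
    exact ⟨(c : ℂ)⁻¹ • w, by rw [hφ, map_smul, smul_smul, mul_inv_cancel₀ hc, one_smul]⟩
  · change ((φ w : K') : H) = π.op g (φ v : K')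
    simp [hφ, hT g v w hw]

variable (π)

/-- An orthogonal decomposition of the Hilbert space into finite dimensional subrepresentations,
each of which is repeated countably often. -/
structure Decomposition where
  ι : Set (Submodule ℂ H)
  K : ι → Submodule ℂ H
  finiteDimensional : ∀ i, FiniteDimensional ℂ (K i)
  J : ∀ i, ℕ → K i →ₗᵢ[ℂ] H
  orthogonal : ∀ i n j m, (i, n) ≠ (j, m) → ∀ v w, ⟪J i n v, J j m w⟫_ℂ = 0
  total : ∀ ξ, (∀ i n v, ⟪J i n v, ξ⟫_ℂ = 0) → ξ = 0
  ρ : ∀ i, G → K i → K i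
  equivariant : ∀ i n g v, π.op g (J i n v) = J i n (ρ i g v)

/-- The orthogonal projection onto an invariant subspace is equivariant. -/
theorem orthogonalProjection_op {K : Submodule ℂ H} (hK : π.IsInvariant K)
    [K.HasOrthogonalProjection] (g : G) (v : H) :
    (K.orthogonalProjectionOnto (π.op g v) : H) = π.op g (K.orthogonalProjectionOnto v) := by
  apply Submodule.eq_starProjection_of_mem_of_inner_eq_zero (hK g _ (Subtype.mem _))
  intro w hw
  rw [inner_sub_left, inner_op_left, inner_op_left, ← inner_sub_left]
  have : (v - K.orthogonalProjectionOnto v) ∈ Kᗮ := Submodule.sub_starProjection_mem_orthogonal v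
  exact Submodule.inner_left_of_mem_orthogonal (hK g⁻¹ w hw) this

/-- In a stable representation each member of a total family of irreducible subspaces is
equivalent to infinitely many others. -/
theorem IsStable.infinite_unitarilyEquivalent (hπ : π.IsStable) {S : Set (Submodule ℂ H)}
    (hS : ∀ K ∈ S, π.IsIrreducibleSubspace K)
    (htot : ∀ ξ : H, (∀ K ∈ S, ∀ v ∈ K, ⟪v, ξ⟫_ℂ = 0) → ξ = 0) {K : Submodule ℂ H} (hK : K ∈ S) :
    Infinite {K' : S // π.UnitarilyEquivalent K K'} := by
  by_contra hfin
  rw [not_infinite_iff_finite] at hfin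
  have hKi := hS K hK
  have := hKi.finiteDimensional
  let n := Module.finrank ℂ K
  let e : K ≃ₗ[ℂ] (Fin n → ℂ) := (Module.finBasis ℂ K).equivFun
  let τ : G → K →ₗ[ℂ] K := fun g => (π.op g).toLinearMap.restrict (hKi.invariant g)
  have hτ : ∀ g v, (τ g v : H) = π.op g v := fun g v => rfl
  let σ : Representation ℂ G (Fin n → ℂ) :=
    { toFun := fun g => e.toLinearMap ∘ₗ τ g ∘ₗ e.symm.toLinearMap
      map_one' := by
        have : τ 1 = LinearMap.id := LinearMap.ext fun v => Subtype.ext (by simp [hτ])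
        exact LinearMap.ext fun v => by simp [this]
      map_mul' := fun g h => by
        have : τ (g * h) = τ g ∘ₗ τ h :=
          LinearMap.ext fun v => Subtype.ext (by simp [hτ, op_mul_apply])
        exact LinearMap.ext fun v => by simp [this] }
  have hσ : ∀ g v, σ g v = e (τ g (e.symm v)) := fun g v => rfl
  refine hπ n σ (fun v => ?_) ?_ ?_
  · simp only [hσ]
    have h1 : Continuous fun g => τ g (e.symm v) :=
      (π.continuous_apply (e.symm v)).subtype_mk _
    exact (LinearMap.continuous_of_finiteDimensional e.toLinearMap).comp h1
  · have hne : Nontrivial K := Submodule.nontrivial_iff_ne_bot.2 hKi.ne_bot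
    have hne' : Nontrivial (Fin n → ℂ) := e.symm.toEquiv.nontrivial
    refine { exists_pair_ne := ?_, eq_bot_or_eq_top := fun P => ?_ }
    · refine ⟨⊥, ⊤, fun h => ?_⟩
      have := congrArg Subrepresentation.toSubmodule h
      exact bot_ne_top this
    · rw [or_iff_not_imp_left]
      intro hP
      have h1 := hKi.eq_of_le (P.toSubmodule.map (K.subtype ∘ₗ e.symm.toLinearMap)) (by
        rintro _ ⟨v, -, rfl⟩; exact (e.symm v).2) (by
        rintro g _ ⟨v, hv, rfl⟩
        refine ⟨σ g v, P.apply_mem_toSubmodule g hv, ?_⟩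
        simp [hσ, hτ]) (by
        have hinj : Function.Injective (K.subtype ∘ₗ e.symm.toLinearMap) :=
          K.injective_subtype.comp e.symm.injective
        rw [ne_eq, ← Submodule.map_bot (K.subtype ∘ₗ e.symm.toLinearMap),
          (Submodule.map_injective_of_injective hinj).eq_iff]
        exact fun h => hP (Subrepresentation.toSubmodule_injective h))
      apply Subrepresentation.toSubmodule_injective
      change P.toSubmodule = ⊤
      rw [eq_top_iff]
      intro v _
      have : (e.symm v : H) ∈ P.toSubmodule.map (K.subtype ∘ₗ e.symm.toLinearMap) :=
        h1.symm ▸ (e.symm v).2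
      obtain ⟨w, hw, hwv⟩ := this
      have : w = v := e.symm.injective (Subtype.ext hwv)
      exact this ▸ hw
  · let C := {K' : S // π.UnitarilyEquivalent K K'}
    have hfd : ∀ K' : S, FiniteDimensional ℂ (K' : Submodule ℂ H) :=
      fun K' => (hS K' K'.2).finiteDimensional
    -- An intertwiner is determined by its projections to the members of the total family. By
    -- Schur's lemma only the members equivalent to `K` contribute; if they were finite in number,
    -- the space of intertwiners would be finite dimensional, against stability.
    let Θ : Representation.IntertwiningMap σ π.toRepresentation →ₗ[ℂ]
        (∀ K' : C, (Fin n → ℂ) →ₗ[ℂ] (K'.1 : Submodule ℂ H)) :=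
      { toFun := fun φ K' =>
          (K'.1 : Submodule ℂ H).orthogonalProjectionOnto.toLinearMap ∘ₗ φ.toLinearMap
        map_add' := fun φ ψ => by ext; simp
        map_smul' := fun c φ => by ext; simp }
    refine Module.Finite.of_injective Θ ?_
    rw [← LinearMap.ker_eq_bot, LinearMap.ker_eq_bot']
    intro φ hφ
    have hφg : ∀ g v, φ.toLinearMap (σ g v) = π.op g (φ.toLinearMap v) := fun g v =>
      LinearMap.congr_fun (φ.isIntertwining' g) v
    have key : ∀ K' : S, ∀ v,
        (K' : Submodule ℂ H).orthogonalProjectionOnto (φ.toLinearMap v) = 0 := by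
      intro K'
      by_cases hC : π.UnitarilyEquivalent K K'
      · intro v
        exact LinearMap.congr_fun (congrFun hφ ⟨K', hC⟩) v
      · by_contra! hv
        obtain ⟨v, hv⟩ := hv
        refine hC (hKi.unitarilyEquivalent (hS K' K'.2)
          (T := (K' : Submodule ℂ H).orthogonalProjectionOnto.toLinearMap ∘ₗ φ.toLinearMap ∘ₗ
            e.toLinearMap) ?_ ?_)
        · intro g x y hy
          have hy' : y = τ g x := Subtype.ext hy
          have h1 : e y = σ g (e x) := by rw [hσ, hy', LinearEquiv.symm_apply_apply]
          change ((K' : Submodule ℂ H).orthogonalProjectionOnto (φ.toLinearMap (e y)) : H) =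
            π.op g ((K' : Submodule ℂ H).orthogonalProjectionOnto (φ.toLinearMap (e x)))
          rw [h1, hφg, π.orthogonalProjection_op (hS K' K'.2).invariant]
        · intro h
          refine hv ?_
          have := LinearMap.congr_fun h (e.symm v)
          simpa using this
    have hz : ∀ v, φ.toLinearMap v = 0 := by
      intro v
      refine htot _ fun K' hK' w hw => ?_
      have := hfd ⟨K', hK'⟩
      have h1 := key ⟨K', hK'⟩ v
      exact Submodule.inner_right_of_mem_orthogonal hw
        (Submodule.orthogonalProjectionOnto_eq_zero_iff.1 h1)
    exact Representation.IntertwiningMap.ext (LinearMap.ext hz)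

variable [IsTopologicalGroup G] [CompactSpace G]

/-- Complete reducibility of unitary representations of compact groups. -/
theorem exists_orthogonal_irreducibles : ∃ S : Set (Submodule ℂ H),
    (∀ K ∈ S, π.IsIrreducibleSubspace K) ∧
    (∀ K ∈ S, ∀ K' ∈ S, K ≠ K' → ∀ v ∈ K, ∀ w ∈ K', ⟪v, w⟫_ℂ = 0) ∧
    ∀ ξ : H, (∀ K ∈ S, ∀ v ∈ K, ⟪v, ξ⟫_ℂ = 0) → ξ = 0 := by
  obtain ⟨S, hS⟩ := zorn_subset {S : Set (Submodule ℂ H) |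
    (∀ K ∈ S, π.IsIrreducibleSubspace K) ∧
    (∀ K ∈ S, ∀ K' ∈ S, K ≠ K' → ∀ v ∈ K, ∀ w ∈ K', ⟪v, w⟫_ℂ = 0)} (by
    intro c hc hchain
    refine ⟨⋃₀ c, ⟨?_, ?_⟩, fun s hs => Set.subset_sUnion_of_mem hs⟩
    · rintro K ⟨s, hs, hK⟩
      exact (hc hs).1 K hK
    · rintro K ⟨s, hs, hK⟩ K' ⟨s', hs', hK'⟩ hne
      rcases hchain.total hs hs' with h | h
      · exact (hc hs').2 K (h hK) K' hK' hne
      · exact (hc hs).2 K hK K' (h hK') hne)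
  refine ⟨S, hS.prop.1, hS.prop.2, ?_⟩
  let M : Submodule ℂ H := (⨆ K ∈ S, K)ᗮ
  have hMmem : ∀ ξ, ξ ∈ M ↔ ∀ K ∈ S, ∀ v ∈ K, ⟪v, ξ⟫_ℂ = 0 := by
    intro ξ
    simp only [M, ← Submodule.iInf_orthogonal, Submodule.mem_iInf, Submodule.mem_orthogonal]
    refine forall_congr' fun K => ?_
    by_cases hK : K ∈ S <;> simp [hK]
  have hM : π.IsInvariant M := by
    intro g ξ hξ
    rw [hMmem] at hξ ⊢
    intro K hK v hv
    rw [← inv_inv g, ← inner_op_left]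
    exact hξ K hK _ ((hS.prop.1 K hK).invariant _ _ hv)
  suffices h : M = ⊥ by
    intro ξ hξ
    have : ξ ∈ M := (hMmem ξ).2 hξ
    simpa [h] using this
  by_contra h0
  obtain ⟨K, hKM, hK⟩ := π.exists_irreducible_le hM (Submodule.isClosed_orthogonal _) h0
  have hperp : ∀ K' ∈ S, ∀ v ∈ K', ∀ w ∈ K, ⟪v, w⟫_ℂ = 0 := fun K' hK' v hv w hw =>
    (hMmem w).1 (hKM hw) K' hK' v hv
  have hmem : K ∈ S := by
    refine hS.le_of_ge (y := insert K S) ⟨?_, ?_⟩ (Set.subset_insert _ _) (Set.mem_insert _ _)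
    · rintro K' (rfl | hK')
      · exact hK
      · exact hS.prop.1 K' hK'
    · rintro K₁ (rfl | hK₁) K₂ (rfl | hK₂) hne v hv w hw
      · exact absurd rfl hne
      · rw [← inner_conj_symm, hperp K₂ hK₂ w hw v hv, map_zero]
      · exact hperp K₁ hK₁ v hv w hw
      · exact hS.prop.2 K₁ hK₁ K₂ hK₂ hne v hv w hw
  apply hK.ne_bot
  rw [eq_bot_iff]
  intro v hv
  exact inner_self_eq_zero.1 (hperp K hmem v hv v hv)

/-- A stable representation is an orthogonal sum of countably repeated finite dimensional ones. -/
theorem IsStable.exists_decomposition (hπ : π.IsStable) : Nonempty π.Decomposition := by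
  obtain ⟨S, hS, horth, htot⟩ := π.exists_orthogonal_irreducibles
  let s : Setoid S :=
    { r := fun K K' => π.UnitarilyEquivalent K.1 K'.1
      iseqv := ⟨fun K => .refl K.1, fun {K _} h => h.symm (hS K.1 K.2).invariant,
        fun h h' => h.trans h'⟩ }
  -- Every equivalence class in `S` is infinite, so `S` can be relabelled by `S × ℕ` within the
  -- classes. Each member then heads a sequence of subspaces equivalent to it, and no choice of one
  -- representative per class is needed.
  obtain ⟨e, he⟩ := exists_prod_nat_equiv_of_infinite_fibers (Quotient.mk s) (by
    intro K
    have h := IsStable.infinite_unitarilyEquivalent π hπ hS htot K.2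
    refine Infinite.of_injective
      (fun x : {K' : S // π.UnitarilyEquivalent K.1 K'} =>
        (⟨x.1, Quotient.sound (x.2.symm (hS K.1 K.2).invariant)⟩ :
          {x // Quotient.mk s x = Quotient.mk s K})) ?_
    intro x y hxy
    simpa [Subtype.ext_iff] using hxy)
  have he' : ∀ K n, π.UnitarilyEquivalent K.1 (e (K, n)).1 := fun K n =>
    Quotient.exact (he K n).symm
  choose φ hφ using he'
  refine ⟨{
    ι := S
    K := fun K => K.1
    finiteDimensional := fun K => (hS K.1 K.2).finiteDimensional
    J := fun K n => (e (K, n)).1.subtypeₗᵢ.comp (φ K n).toLinearIsometry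
    orthogonal := ?_
    total := ?_
    ρ := fun K g v => ⟨π.op g v, (hS K.1 K.2).invariant g _ v.2⟩
    equivariant := fun K n g v => (hφ K n g v _ rfl).symm }⟩
  · intro i n j m hne v w
    have hne' : (e (i, n)).1 ≠ (e (j, m)).1 := fun h => hne (e.injective (Subtype.ext h))
    exact horth _ (e (i, n)).2 _ (e (j, m)).2 hne' _ (φ i n v).2 _ (φ j m w).2
  · intro ξ hξ
    refine htot ξ fun K hK v hv => ?_
    obtain ⟨⟨i, n⟩, hin⟩ := e.surjective ⟨K, hK⟩
    have hv' : v ∈ (e (i, n)).1 := by rw [hin]; exact hv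
    have := hξ i n ((φ i n).symm ⟨v, hv'⟩)
    simpa using this

end Decomposition

end GHilbertStructure

end UnitaryRepresentations

/-! ### Recursive choices and enumeration of the components of a graph. -/

section Sections

open InnerProductSpace
open scoped InnerProductSpace

/-- Dependent choice along a natural number valued rank, for a condition which only involves
the values of smaller rank. -/
theorem exists_forall_of_rank {α : Type*} {β : α → Type*} [∀ a, Nonempty (β a)] (k : α → ℕ)
    (P : ∀ a, (∀ b, β b) → β a → Prop)
    (hloc : ∀ a f f' x, (∀ b, k b < k a → f b = f' b) → P a f x → P a f' x)
    (hex : ∀ a f, ∃ x, P a f x) : ∃ f : ∀ a, β a, ∀ a, P a f (f a) := by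
  classical
  let ext : ∀ a, (∀ b, k b < k a → β b) → ∀ b, β b :=
    fun a g b => if h : k b < k a then g b h else Classical.arbitrary _
  let F : ∀ a, (∀ b, k b < k a → β b) → β a := fun a g => (hex a (ext a g)).choose
  let f : ∀ a, β a := (measure k).wf.fix F
  have hf : ∀ a, f a = F a (fun b _ => f b) := fun a => (measure k).wf.fix_eq F a
  refine ⟨f, fun a => ?_⟩
  refine hloc a (ext a fun b _ => f b) f (f a) (fun b hb => by simp [ext, hb]) ?_
  rw [hf a]
  exact (hex a (ext a fun b _ => f b)).choose_spec

/-- The components of a locally countable graph are countable, so they can be enumerated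
simultaneously. -/
theorem exists_component_code {α : Type*} (r : α → α → Prop) (hs : ∀ a b, r a b → r b a)
    (hc : ∀ a, {b | r a b}.Countable) :
    ∃ (q : α → α) (c : α → ℕ), (∀ a b, r a b → q a = q b) ∧
      ∀ a b, q a = q b → c a = c b → a = b := by
  have hcount : ∀ a, {b | Relation.ReflTransGen r a b}.Countable := by
    intro a
    let S : ℕ → Set α := fun n => Nat.rec {a} (fun _ s => ⋃ x ∈ s, {b | r x b}) n
    have hS : ∀ n, (S n).Countable := by
      intro n
      induction n with
      | zero => exact Set.countable_singleton a
      | succ n ih => exact ih.biUnion fun x _ => hc x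
    refine (Set.countable_iUnion hS).mono fun b hb => ?_
    rw [Set.mem_iUnion]
    induction (show Relation.ReflTransGen r a b from hb) with
    | refl => exact ⟨0, rfl⟩
    | tail _ h ih =>
      obtain ⟨n, hn⟩ := ih ‹_›
      exact ⟨n + 1, Set.mem_biUnion hn h⟩
  let s : Setoid α :=
    { r := Relation.ReflTransGen r
      iseqv := ⟨fun _ => .refl, fun h => by
        induction h with
        | refl => exact .refl
        | tail _ h ih => exact (Relation.ReflTransGen.single (hs _ _ h)).trans ih,
        fun h h' => h.trans h'⟩ }
  choose f hf using fun a => Set.countable_iff_exists_injOn.1 (hcount a)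
  let q : α → α := fun a => (Quotient.mk s a).out
  have hq : ∀ a, Relation.ReflTransGen r (q a) a := fun a => Quotient.mk_out (s := s) a
  refine ⟨q, fun a => f (q a) a, fun a b h => ?_, fun a b h h' => ?_⟩
  · have : Quotient.mk s a = Quotient.mk s b := Quotient.sound (.single h)
    simp only [q, this]
  · have hb := hq b
    simp only [← h] at h' hb
    exact hf (q a) (hq a) hb h'

theorem Submodule.finrank_biSup_le {ι V : Type*} [AddCommGroup V] [Module ℂ V]
    [FiniteDimensional ℂ V] (s : Finset ι) (W : ι → Submodule ℂ V) :
    Module.finrank ℂ (⨆ i ∈ s, W i : Submodule ℂ V) ≤ ∑ i ∈ s, Module.finrank ℂ (W i) := by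
  classical
  induction s using Finset.induction_on with
  | empty => simp
  | insert a s ha ih =>
    rw [Finset.iSup_insert, Finset.sum_insert ha]
    exact (Submodule.finrank_add_le_finrank_add_finrank _ _).trans (by omega)

/-! ### Thin subspaces and Kuiper's lemma. -/

namespace GHilbertStructure

namespace Decomposition

variable {G : Type*} [Group G] [TopologicalSpace G]
  {H : Type*} [NormedAddCommGroup H] [InnerProductSpace ℂ H] [CompleteSpace H]
  {π : GHilbertStructure G H} (D : π.Decomposition)

instance (i : D.ι) : FiniteDimensional ℂ (D.K i) := D.finiteDimensional i

instance (i : D.ι) : CompleteSpace (D.K i) := FiniteDimensional.complete ℂ _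

theorem orthogonalFamily :
    OrthogonalFamily ℂ (fun p : D.ι × ℕ => D.K p.1) fun p => D.J p.1 p.2 :=
  fun p q hpq v w => D.orthogonal p.1 p.2 q.1 q.2 hpq v w

theorem isHilbertSum : IsHilbertSum ℂ (fun p : D.ι × ℕ => D.K p.1) fun p => D.J p.1 p.2 := by
  refine IsHilbertSum.mk D.orthogonalFamily ?_
  rw [top_le_iff, Submodule.topologicalClosure_eq_top_iff, eq_bot_iff]
  intro ξ hξ
  rw [Submodule.mem_orthogonal] at hξ
  refine D.total ξ fun i n v => hξ _ ?_
  exact Submodule.mem_iSup_of_mem (i, n) ⟨v, rfl⟩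

/-- Coordinates of a vector with respect to the decomposition. -/
noncomputable def coords : H ≃ₗᵢ[ℂ] lp (fun p : D.ι × ℕ => D.K p.1) 2 :=
  D.isHilbertSum.linearIsometryEquiv

theorem coords_J [DecidableEq (D.ι × ℕ)] (p : D.ι × ℕ) (v : D.K p.1) :
    D.coords (D.J p.1 p.2 v) = lp.single 2 p v := by
  rw [← D.isHilbertSum.linearIsometryEquiv_symm_apply_single v]
  exact LinearIsometryEquiv.apply_symm_apply _ _

theorem inner_J (p : D.ι × ℕ) (w : D.K p.1) (ξ : H) :
    ⟪D.J p.1 p.2 w, ξ⟫_ℂ = ⟪w, D.coords ξ p⟫_ℂ := by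
  classical
  rw [← D.coords.inner_map_map, coords_J, lp.inner_single_left]

/-- There may be uncountably many summands. This countability lets Kuiper's recursion run with
finite ranks on each component of the summands linked by the operators. -/
theorem countable_inner_ne_zero (ξ : H) :
    {i | ∃ n w, ⟪D.J i n w, ξ⟫_ℂ ≠ 0}.Countable := by
  have h1 : Summable fun p => ‖D.coords ξ p‖ ^ 2 := by
    simpa using (lp.memℓp (D.coords ξ)).summable (by norm_num)
  refine (h1.countable_support.image Prod.fst).mono ?_
  rintro i ⟨n, w, h⟩
  refine ⟨(i, n), ?_, rfl⟩
  intro h0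
  apply h
  rw [D.inner_J (i, n)]
  have : D.coords ξ (i, n) = 0 := by simpa using h0
  rw [this, inner_zero_right]

/-- Isometries `v ↦ ∑ j, a j • J i j v` onto diagonal copies of a summand. -/
def IsCombination {i : D.ι} (L : D.K i →ₗᵢ[ℂ] H) : Prop :=
  ∃ (n : ℕ) (a : Fin n → ℂ), ∀ v, L v = ∑ j, a j • D.J i j v

theorem IsCombination.op_apply {D : π.Decomposition} {i : D.ι} {L : D.K i →ₗᵢ[ℂ] H}
    (hL : D.IsCombination L) (g : G) (v : D.K i) : π.op g (L v) = L (D.ρ i g v) := by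
  obtain ⟨n, a, h⟩ := hL
  simp only [h, map_sum, map_smul, D.equivariant]

theorem IsCombination.inner_eq_zero {D : π.Decomposition} {i : D.ι} {L : D.K i →ₗᵢ[ℂ] H}
    (hL : D.IsCombination L) {ξ : H} (h : ∀ n v, ⟪ξ, D.J i n v⟫_ℂ = 0) (v : D.K i) :
    ⟪ξ, L v⟫_ℂ = 0 := by
  obtain ⟨n, a, ha⟩ := hL
  simp only [ha, inner_sum, inner_smul_right, h, mul_zero, Finset.sum_const_zero]

/-- The first `n` coordinates of the component of a vector in the isotypical part of `i`. -/
noncomputable def firstCoords (i : D.ι) (n : ℕ) : H →ₗ[ℂ] (Fin n → D.K i) :=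
  LinearMap.pi fun j => (ContinuousLinearMap.adjoint (D.J i j).toContinuousLinearMap).toLinearMap

theorem inner_firstCoords (i : D.ι) (n : ℕ) (ξ : H) (j : Fin n) (v : D.K i) :
    ⟪D.firstCoords i n ξ j, v⟫_ℂ = ⟪ξ, D.J i j v⟫_ℂ := by
  simp [firstCoords, ContinuousLinearMap.adjoint_inner_left]

theorem firstCoords_eq_zero {i : D.ι} {n : ℕ} {ξ : H}
    (h : ∀ j < n, ∀ v, ⟪ξ, D.J i j v⟫_ℂ = 0) : D.firstCoords i n ξ = 0 := by
  ext1 j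
  refine ext_inner_right ℂ fun v => ?_
  rw [inner_firstCoords, h j j.2, Pi.zero_apply, inner_zero_left]

/-- A subspace is thin if its components have density zero. -/
def IsThin (Z : Submodule ℂ H) : Prop :=
  ∀ i C, ∃ N, ∀ n ≥ N, C * Module.finrank ℂ (Z.map (D.firstCoords i n)) ≤ n

theorem isThin_of_finiteDimensional (Z : Submodule ℂ H) [FiniteDimensional ℂ Z] : D.IsThin Z := by
  intro i C
  refine ⟨C * Module.finrank ℂ Z, fun n hn => le_trans ?_ hn⟩
  exact Nat.mul_le_mul_left _ (Submodule.finrank_map_le _ _)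

theorem IsThin.sup {D : π.Decomposition} {Z Z' : Submodule ℂ H} (h : D.IsThin Z)
    (h' : D.IsThin Z') : D.IsThin (Z ⊔ Z') := by
  intro i C
  obtain ⟨N, hN⟩ := h i (2 * C)
  obtain ⟨N', hN'⟩ := h' i (2 * C)
  refine ⟨max N N', fun n hn => ?_⟩
  have h1 := hN n (le_trans (le_max_left _ _) hn)
  have h2 := hN' n (le_trans (le_max_right _ _) hn)
  rw [Submodule.map_sup]
  have h3 := Nat.mul_le_mul_left C (Submodule.finrank_add_le_finrank_add_finrank
    (Z.map (D.firstCoords i n)) (Z'.map (D.firstCoords i n)))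
  rw [Nat.mul_add] at h3
  rw [mul_assoc] at h1 h2
  omega

theorem IsThin.biSup {D : π.Decomposition} {α : Type*} (s : Finset α) {Z : α → Submodule ℂ H}
    (h : ∀ a ∈ s, D.IsThin (Z a)) : D.IsThin (⨆ a ∈ s, Z a) := by
  classical
  induction s using Finset.induction_on with
  | empty => simpa using D.isThin_of_finiteDimensional ⊥
  | insert a s ha ih =>
    rw [Finset.iSup_insert]
    exact (h a (Finset.mem_insert_self _ _)).sup
      (ih fun b hb => h b (Finset.mem_insert_of_mem hb))

theorem norm_sum_J (i : D.ι) {n : ℕ} (a : Fin n → ℂ) (v : D.K i) :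
    ‖∑ j, a j • D.J i j v‖ ^ 2 = (∑ j, ‖a j‖ ^ 2) * ‖v‖ ^ 2 := by
  have h := (D.orthogonalFamily.comp (γ := Fin n) (f := fun j => (i, (j : ℕ)))
    (fun j k h => by simpa [Fin.ext_iff] using h)).norm_sum (fun j => a j • v) Finset.univ
  simp only [map_smul, norm_smul, mul_pow] at h
  rw [Finset.sum_mul]
  exact h

/-- Orthogonally to a thin subspace there is a further copy of each summand. -/
theorem IsThin.exists_combination {D : π.Decomposition} {Z : Submodule ℂ H} (hZ : D.IsThin Z)
    (i : D.ι) : ∃ L : D.K i →ₗᵢ[ℂ] H, D.IsCombination L ∧ ∀ z ∈ Z, ∀ v, ⟪z, L v⟫_ℂ = 0 := by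
  let d := Module.finrank ℂ (D.K i)
  -- The copy `v ↦ ∑ j, a j • D.J i j v` is orthogonal to `Z` once `a` satisfies `f * d` linear
  -- equations in `n` unknowns. The factor `d + 1` makes `f * d < n` when `f` is positive, and `n =
  -- N + 1` settles `f = 0`.
  obtain ⟨N, hN⟩ := hZ i (d + 1)
  let n := N + 1
  let W := Z.map (D.firstCoords i n)
  let f := Module.finrank ℂ W
  have hlt : f * d < n := by
    have h1 : (d + 1) * f ≤ n := hN n (Nat.le_succ N)
    rcases Nat.eq_zero_or_pos f with h0 | h0
    · rw [h0]; omega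
    · nlinarith
  let w := Module.finBasis ℂ W
  let b := Module.finBasis ℂ (D.K i)
  let Θ : (Fin n → ℂ) →ₗ[ℂ] (Fin f × Fin d → ℂ) := LinearMap.pi fun p =>
    ∑ j, ⟪(w p.1 : Fin n → D.K i) j, b p.2⟫_ℂ • LinearMap.proj j
  have hker : LinearMap.ker Θ ≠ ⊥ := LinearMap.ker_ne_bot_of_finrank_lt (by simpa using hlt)
  obtain ⟨a, ha, ha0⟩ := Submodule.exists_mem_ne_zero_of_ne_bot hker
  have hΘ : ∀ s t, ∑ j, ⟪(w s : Fin n → D.K i) j, b t⟫_ℂ * a j = 0 := fun s t => by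
    have := congrFun (show Θ a = 0 from ha) (s, t)
    simpa [Θ] using this
  let T : (Fin n → D.K i) →ₗ⋆[ℂ] (D.K i →ₗ[ℂ] ℂ) :=
    ∑ j, a j • (innerₛₗ ℂ).comp (LinearMap.proj j : (Fin n → D.K i) →ₗ[ℂ] D.K i)
  have hT : ∀ x v, T x v = ∑ j, ⟪x j, v⟫_ℂ * a j := fun x v => by
    simp [T, mul_comm]
  have hT0 : ∀ x ∈ W, T x = 0 := by
    intro x hx
    have h1 := w.sum_repr ⟨x, hx⟩
    have h2 : x = ∑ s, w.repr ⟨x, hx⟩ s • (w s : Fin n → D.K i) := by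
      have := congrArg W.subtype h1
      rw [map_sum] at this
      exact this.symm
    rw [h2, map_sum]
    refine Finset.sum_eq_zero fun s _ => ?_
    rw [map_smulₛₗ]
    have : T (w s) = 0 := b.ext fun t => by rw [hT, hΘ]; rfl
    rw [this, smul_zero]
  have hr : 0 < ∑ j, ‖a j‖ ^ 2 := by
    obtain ⟨j, hj⟩ := Function.ne_iff.1 ha0
    refine Finset.sum_pos' (fun j _ => by positivity) ⟨j, Finset.mem_univ j, ?_⟩
    have : a j ≠ 0 := hj
    positivity
  let r : ℝ := Real.sqrt (∑ j, ‖a j‖ ^ 2)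
  have hr0 : 0 < r := Real.sqrt_pos.2 hr
  let L : D.K i →ₗᵢ[ℂ] H :=
    ⟨((r⁻¹ : ℝ) : ℂ) • ∑ j, a j • (D.J i j).toLinearMap, fun v => by
      have h1 : ‖∑ j, a j • D.J i j v‖ = r * ‖v‖ := by
        rw [← Real.sqrt_sq (norm_nonneg (∑ j, a j • D.J i j v)), D.norm_sum_J,
          Real.sqrt_mul hr.le, Real.sqrt_sq (norm_nonneg v)]
      simp only [LinearMap.smul_apply, LinearMap.sum_apply, LinearIsometry.coe_toLinearMap]
      rw [norm_smul, Complex.norm_real, Real.norm_of_nonneg (by positivity), h1,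
        inv_mul_cancel_left₀ hr0.ne']⟩
  have hL : ∀ v, L v = ((r⁻¹ : ℝ) : ℂ) • ∑ j, a j • D.J i j v := fun v => by
    change (((r⁻¹ : ℝ) : ℂ) • ∑ j, a j • (D.J i j).toLinearMap) v = _
    simp
  refine ⟨L, ⟨n, fun j => ((r⁻¹ : ℝ) : ℂ) * a j, fun v => ?_⟩, fun z hz v => ?_⟩
  · rw [hL, Finset.smul_sum]
    simp only [smul_smul]
  · have h1 : T (D.firstCoords i n z) v = 0 := by
      rw [hT0 _ (Submodule.mem_map_of_mem hz)]; rfl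
    rw [hT] at h1
    simp only [inner_firstCoords] at h1
    rw [hL, inner_smul_right, inner_sum]
    simp only [inner_smul_right]
    rw [Finset.sum_congr rfl fun j _ => mul_comm (a j) _, h1, mul_zero]

theorem inner_apply_eq_zero_symm {U : Finset (H →L[ℂ] H)}
    (hU : ∀ u ∈ U, ContinuousLinearMap.adjoint u ∈ U) {ξ η : H}
    (h : ∀ u ∈ U, ⟪u ξ, η⟫_ℂ = 0) : ∀ u ∈ U, ⟪u η, ξ⟫_ℂ = 0 := by
  intro u hu
  rw [← ContinuousLinearMap.adjoint_inner_right, ← inner_conj_symm, h _ (hU u hu), map_zero]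

/-- Kuiper's lemma. Given finitely many operators, there is a system of copies of all summands
which is moved by these operators in mutually orthogonal directions, avoids a given thin
subspace, and only spans a thin subspace itself. -/
theorem exists_thin_family (U : Finset (H →L[ℂ] H))
    (hU : ∀ u ∈ U, ContinuousLinearMap.adjoint u ∈ U) {Z : Submodule ℂ H} (hZ : D.IsThin Z) :
    ∃ L : ∀ p : D.ι × ℕ, D.K p.1 →ₗᵢ[ℂ] H, (∀ p, D.IsCombination (L p)) ∧
      (∀ p, ∀ z ∈ Z, ∀ v, ⟪z, L p v⟫_ℂ = 0) ∧
      (∀ u ∈ U, ∀ p q, p ≠ q → ∀ v w, ⟪u (L p v), L q w⟫_ℂ = 0) ∧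
      D.IsThin (⨆ u ∈ U, ⨆ p, (LinearMap.range (L p).toLinearMap).map u.toLinearMap) := by
  classical
  -- Summands are linked when some operator in `U` has a nonzero matrix entry between them.
  -- Different components do not interact, so each can be treated by its own countable recursion,
  -- all running simultaneously.
  let r : D.ι → D.ι → Prop := fun i j => ∃ u ∈ U, ∃ n v m w, ⟪u (D.J i n v), D.J j m w⟫_ℂ ≠ 0
  have hrs : ∀ i j, r i j → r j i := by
    rintro i j ⟨u, hu, n, v, m, w, h⟩
    by_contra hr
    refine h (inner_apply_eq_zero_symm hU (fun u' hu' => ?_) u hu)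
    by_contra h'
    exact hr ⟨u', hu', m, w, n, v, h'⟩
  have hrc : ∀ i, {j | r i j}.Countable := by
    intro i
    let b := Module.finBasis ℂ (D.K i)
    have h1 : (⋃ u ∈ U, ⋃ n : ℕ, ⋃ t,
        {j | ∃ m w, ⟪D.J j m w, u (D.J i n (b t))⟫_ℂ ≠ 0}).Countable :=
      U.countable_toSet.biUnion fun u _ => Set.countable_iUnion fun n =>
        Set.countable_iUnion fun t => D.countable_inner_ne_zero _
    refine h1.mono ?_
    rintro j ⟨u, hu, n, v, m, w, h⟩
    simp only [Set.mem_iUnion]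
    by_contra! hne
    apply h
    have h2 : ∀ t, ⟪D.J j m w, u (D.J i n (b t))⟫_ℂ = 0 := by
      intro t
      by_contra h3
      exact hne u hu n t ⟨m, w, h3⟩
    rw [← b.sum_repr v]
    simp only [map_sum, map_smul, sum_inner, inner_smul_left]
    refine Finset.sum_eq_zero fun t _ => ?_
    rw [← inner_conj_symm, h2, map_zero, mul_zero]
  obtain ⟨q, c, hq, hc⟩ := exists_component_code r hrs hrc
  have horth : ∀ i j, q i ≠ q j → ∀ u ∈ U, ∀ n v m w, ⟪u (D.J i n v), D.J j m w⟫_ℂ = 0 := by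
    intro i j hij u hu n v m w
    by_contra h
    exact hij (hq i j ⟨u, hu, n, v, m, w, h⟩)
  -- The rank is injective only within a component. Hence each component has finitely many members
  -- below a given rank.
  let k : D.ι × ℕ → ℕ := fun p => Nat.pair (c p.1) p.2
  have hk : ∀ p p', q p.1 = q p'.1 → k p = k p' → p = p' := by
    intro p p' h h'
    obtain ⟨h1, h2⟩ := Nat.pair_eq_pair.1 h'
    exact Prod.ext (hc _ _ h h1) h2
  have hfin : ∀ i N, {p : D.ι × ℕ | q p.1 = q i ∧ k p < N}.Finite := by
    intro i N
    refine Set.Finite.of_finite_image (f := k) ((Set.finite_lt_nat N).subset ?_) ?_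
    · rintro _ ⟨p, hp, rfl⟩; exact hp.2
    · intro p hp p' hp' h
      exact hk p p' (hp.1.trans hp'.1.symm) h
  have hcfin : ∀ i N, {l : D.ι | q l = q i ∧ c l ≤ N}.Finite := by
    intro i N
    refine Set.Finite.of_finite_image (f := c) ((Set.finite_le_nat N).subset ?_) ?_
    · rintro _ ⟨p, hp, rfl⟩; exact hp.2
    · intro p hp p' hp' h
      exact hc p p' (hp.1.trans hp'.1.symm) h
  -- A bound for the dimension of the span of all images under `U` of the copies of rank below `N`
  -- in the component of `i`.
  let wt : D.ι → ℕ → ℕ := fun i N =>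
    U.card * ∑ p ∈ (hfin i N).toFinset, Module.finrank ℂ (D.K p.1)
  -- The copy of index `p` will avoid the images of the first `m p` coordinates. This cutoff exceeds
  -- `k p + 1` times the dimension used up through rank `k p`, which forces density zero.
  let m : D.ι × ℕ → ℕ := fun p => (k p + 1) * (1 + wt p.1 (k p + 1))
  have hne : ∀ p : D.ι × ℕ, Nonempty (D.K p.1 →ₗᵢ[ℂ] H) := fun p => ⟨D.J p.1 p.2⟩
  -- Besides avoiding `Z` and the images of earlier copies, each copy avoids the images of an
  -- initial block of the original summands. All these span a thin subspace, so a further copy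
  -- exists.
  have hrec := exists_forall_of_rank (β := fun p : D.ι × ℕ => D.K p.1 →ₗᵢ[ℂ] H) k
    (fun p f x => D.IsCombination x ∧ (∀ z ∈ Z, ∀ v, ⟪z, x v⟫_ℂ = 0) ∧
      (∀ u ∈ U, ∀ p', q p'.1 = q p.1 → k p' < k p → ∀ w v, ⟪u (f p' w), x v⟫_ℂ = 0) ∧
      (∀ u ∈ U, ∀ l, q l = q p.1 → c l ≤ k p → ∀ n < m p, ∀ w v,
        ⟪u (D.J l n w), x v⟫_ℂ = 0)) ?_ ?_
  rotate_left
  · rintro p f f' x hff ⟨h1, h2, h3, h4⟩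
    refine ⟨h1, h2, fun u hu p' hp' hk' => ?_, h4⟩
    rw [← hff p' hk']
    exact h3 u hu p' hp' hk'
  · intro p f
    have := (hfin p.1 (k p)).to_subtype
    have := (hcfin p.1 (k p)).to_subtype
    let Y₁ : Submodule ℂ H := ⨆ (u : U) (p' : {p' : D.ι × ℕ | q p'.1 = q p.1 ∧ k p' < k p}),
      (LinearMap.range (f p').toLinearMap).map u.1.toLinearMap
    let Y₂ : Submodule ℂ H := ⨆ (u : U) (l : {l : D.ι | q l = q p.1 ∧ c l ≤ k p}) (n : Fin (m p)),
      (LinearMap.range (D.J l n).toLinearMap).map u.1.toLinearMap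
    obtain ⟨L, hL, hL'⟩ := ((hZ.sup (D.isThin_of_finiteDimensional Y₁)).sup
      (D.isThin_of_finiteDimensional Y₂)).exists_combination p.1
    refine ⟨L, hL, fun z hz => hL' z (Submodule.mem_sup_left (Submodule.mem_sup_left hz)),
      fun u hu p' hp' hk' w => hL' _ (Submodule.mem_sup_left (Submodule.mem_sup_right ?_)),
      fun u hu l hl hcl n hn w => hL' _ (Submodule.mem_sup_right ?_)⟩
    · exact Submodule.mem_iSup_of_mem ⟨u, hu⟩ (Submodule.mem_iSup_of_mem ⟨p', hp', hk'⟩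
        ⟨_, ⟨w, rfl⟩, rfl⟩)
    · exact Submodule.mem_iSup_of_mem ⟨u, hu⟩ (Submodule.mem_iSup_of_mem ⟨l, hl, hcl⟩
        (Submodule.mem_iSup_of_mem ⟨n, hn⟩ ⟨_, ⟨w, rfl⟩, rfl⟩))
  obtain ⟨L, hL⟩ := hrec
  have hdiff : ∀ u ∈ U, ∀ p j, q p.1 ≠ q j → ∀ v n w, ⟪u (L p v), D.J j n w⟫_ℂ = 0 := by
    intro u hu p j hj v n w
    refine inner_apply_eq_zero_symm hU (fun u' hu' => ?_) u hu
    exact (hL p).1.inner_eq_zero (fun n' v' => horth j p.1 (Ne.symm hj) u' hu' n w n' v') v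
  refine ⟨L, fun p => (hL p).1, fun p => (hL p).2.1, ?_, ?_⟩
  · intro u hu p p' hne v w
    by_cases hqq : q p.1 = q p'.1
    · rcases lt_trichotomy (k p) (k p') with h | h | h
      · exact (hL p').2.2.1 u hu p hqq h v w
      · exact absurd (hk p p' hqq h) hne
      · exact inner_apply_eq_zero_symm hU
          (fun u' hu' => (hL p).2.2.1 u' hu' p' hqq.symm h w v) u hu
    · exact (hL p').1.inner_eq_zero (fun n w' => hdiff u hu p p'.1 hqq v n w') w
  · intro l C
    let N₀ := max (c l) C
    refine ⟨C * wt l N₀, fun n hn => ?_⟩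
    -- Only these copies can contribute to the first `n` coordinates at `l`: outside `T` the copy
    -- lies in another component or was chosen orthogonal to these coordinates.
    let T : Set (D.ι × ℕ) := {p | q p.1 = q l ∧ (k p < c l ∨ m p < n)}
    have hzero : ∀ u ∈ U, ∀ p ∉ T, ∀ v, D.firstCoords l n (u (L p v)) = 0 := by
      intro u hu p hp v
      refine D.firstCoords_eq_zero fun j hj w => ?_
      by_cases hqq : q p.1 = q l
      · have hp' : c l ≤ k p ∧ n ≤ m p := by
          by_contra h
          exact hp ⟨hqq, by omega⟩
        exact inner_apply_eq_zero_symm hU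
          (fun u' hu' => (hL p).2.2.2 u' hu' l hqq.symm hp'.1 j (hj.trans_le hp'.2) w v) u hu
      · exact hdiff u hu p l hqq v j w
    have hbound : ∀ N, (∀ p ∈ T, k p < N) → Module.finrank ℂ
        ((⨆ u ∈ U, ⨆ p, (LinearMap.range (L p).toLinearMap).map u.toLinearMap).map
          (D.firstCoords l n)) ≤ wt l N := by
      intro N hN
      let V : (H →L[ℂ] H) × (D.ι × ℕ) → Submodule ℂ (Fin n → D.K l) := fun x =>
        ((LinearMap.range (L x.2).toLinearMap).map x.1.toLinearMap).map (D.firstCoords l n)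
      have hle : (⨆ u ∈ U, ⨆ p, (LinearMap.range (L p).toLinearMap).map u.toLinearMap).map
          (D.firstCoords l n) ≤ ⨆ x ∈ U ×ˢ (hfin l N).toFinset, V x := by
        simp only [Submodule.map_iSup]
        refine iSup₂_le fun u hu => iSup_le fun p => ?_
        by_cases hp : p ∈ T
        · refine le_iSup₂_of_le (u, p) ?_ le_rfl
          simp only [Finset.mem_product, Set.Finite.mem_toFinset]
          exact ⟨hu, hp.1, hN p hp⟩
        · rintro _ ⟨_, ⟨_, ⟨v, rfl⟩, rfl⟩, rfl⟩
          have h0 := hzero u hu p hp v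
          change D.firstCoords l n (u (L p v)) ∈ _
          rw [h0]
          exact Submodule.zero_mem _
      refine (Submodule.finrank_mono hle).trans ((Submodule.finrank_biSup_le _ _).trans ?_)
      rw [Finset.sum_product]
      refine (Finset.sum_le_card_nsmul U _ _ fun u _ => ?_).trans (le_of_eq (smul_eq_mul _ _))
      refine Finset.sum_le_sum fun p _ => ?_
      exact (Submodule.finrank_map_le _ _).trans ((Submodule.finrank_map_le _ _).trans
        (LinearMap.finrank_range_le _))
    have hm : ∀ p, k p < m p := fun p => by
      have : (k p + 1) * 1 ≤ m p := Nat.mul_le_mul_left _ (Nat.le_add_right _ _)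
      omega
    have hTfin : T.Finite := by
      refine (hfin l (max (c l) n)).subset fun p hp => ⟨hp.1, ?_⟩
      rcases hp.2 with h | h
      · exact h.trans_le (le_max_left _ _)
      · exact ((hm p).trans h).trans_le (le_max_right _ _)
    by_cases hcase : ∀ p ∈ T, k p < N₀
    · exact (Nat.mul_le_mul_left C (hbound N₀ hcase)).trans hn
    -- Take a contributing copy `p` of maximal rank. Its rank is at least `c l`, so it contributes
    -- only because `m p < n`; its rank is also at least `C`, so `m p` dominates `C` times the whole
    -- dimension.
    · push Not at hcase
      obtain ⟨p₀, hp₀, hkp₀⟩ := hcase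
      obtain ⟨p, hp, hmax⟩ := hTfin.exists_maximalFor k T ⟨p₀, hp₀⟩
      have hmax' : ∀ p' ∈ T, k p' ≤ k p := fun p' hp' => by
        by_contra h
        exact h (hmax hp' (not_le.1 h).le)
      have hN₀ : N₀ ≤ k p := hkp₀.trans (hmax' p₀ hp₀)
      have h1 := hbound (k p + 1) fun p' hp' => Nat.lt_succ_of_le (hmax' p' hp')
      have h2 : m p < n := by
        rcases hp.2 with h | h
        · exact absurd ((le_max_left _ _).trans hN₀) (not_le.2 h)
        · exact h
      have h3 : wt p.1 (k p + 1) = wt l (k p + 1) := by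
        simp only [wt, hp.1]
      have hC : C ≤ k p + 1 := ((le_max_right _ _).trans hN₀).trans (Nat.le_succ _)
      calc C * _ ≤ (k p + 1) * wt l (k p + 1) := Nat.mul_le_mul hC h1
        _ ≤ m p := by
          rw [← h3]
          exact Nat.mul_le_mul_left _ (Nat.le_add_left _ _)
        _ ≤ n := h2.le

end Decomposition

end GHilbertStructure

/-! ### Infinite amplifications and the isometries of the swindle. -/

section Amplification

variable {H : Type*} [NormedAddCommGroup H] [InnerProductSpace ℂ H] [CompleteSpace H]

theorem ContinuousLinearMap.star_apply_inner (A : H →L[ℂ] H) (x y : H) :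
    ⟪(star A) x, y⟫_ℂ = ⟪x, A y⟫_ℂ := by
  rw [ContinuousLinearMap.star_eq_adjoint, ContinuousLinearMap.adjoint_inner_left]

theorem LinearIsometry.star_mul_self (L : H →ₗᵢ[ℂ] H) :
    star L.toContinuousLinearMap * L.toContinuousLinearMap = 1 := by
  refine ContinuousLinearMap.ext fun x => ext_inner_right ℂ fun y => ?_
  simp [ContinuousLinearMap.star_apply_inner]

/-- Operators that agree on subspaces with dense span are equal. -/
theorem ContinuousLinearMap.ext_of_total {ι : Type*} {E : ι → Type*} (J : ∀ i, E i → H)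
    (hJ : ∀ ξ, (∀ i v, ⟪J i v, ξ⟫_ℂ = 0) → ξ = 0) {A B : H →L[ℂ] H}
    (h : ∀ i v, A (J i v) = B (J i v)) : A = B := by
  rw [← star_inj]
  ext1 ξ
  rw [← sub_eq_zero]
  refine hJ _ fun i v => ?_
  rw [inner_sub_right, ← inner_conj_symm, star_apply_inner, ← inner_conj_symm _ (star B ξ),
    star_apply_inner, h, sub_self]

/-- Given a decomposition of a Hilbert space into countably many copies of itself, every operator
can be amplified. -/
theorem exists_amplification (V : ℕ → H →ₗᵢ[ℂ] H)
    (hV : ∀ n m, n ≠ m → ∀ x y, ⟪V n x, V m y⟫_ℂ = 0)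
    (htot : ∀ ξ, (∀ n x, ⟪V n x, ξ⟫_ℂ = 0) → ξ = 0) :
    ∃ Φ : (H →L[ℂ] H) →+* (H →L[ℂ] H), Continuous Φ ∧ ∀ a n x, Φ a (V n x) = V n (a x) := by
  classical
  have hsum : IsHilbertSum ℂ (fun _ : ℕ => H) V := by
    refine IsHilbertSum.mk (fun n m hnm x y => hV n m hnm x y) ?_
    rw [top_le_iff, Submodule.topologicalClosure_eq_top_iff, eq_bot_iff]
    intro ξ hξ
    rw [Submodule.mem_orthogonal] at hξ
    exact htot ξ fun n x => hξ _ (Submodule.mem_iSup_of_mem n ⟨x, rfl⟩)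
  let C := hsum.linearIsometryEquiv
  let Φ : (H →L[ℂ] H) → (H →L[ℂ] H) := fun a =>
    C.symm.toContinuousLinearEquiv.toContinuousLinearMap ∘L
      (lp.mapCLM 2 (fun _ : ℕ => a) (norm_nonneg a) (fun _ => le_rfl)) ∘L
      C.toContinuousLinearEquiv.toContinuousLinearMap
  have hC : ∀ n x, C (V n x) = lp.single 2 n x := fun n x => by
    rw [← hsum.linearIsometryEquiv_symm_apply_single x]
    exact LinearIsometryEquiv.apply_symm_apply _ _
  have hΦ : ∀ a n x, Φ a (V n x) = V n (a x) := fun a n x => by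
    apply C.injective
    change C (C.symm _) = _
    rw [LinearIsometryEquiv.apply_symm_apply, hC]
    change lp.mapCLM 2 (fun _ : ℕ => a) (norm_nonneg a) (fun _ => le_rfl) (C (V n x)) = _
    rw [hC]
    ext m
    by_cases h : m = n
    · subst h; simp
    · simp [h]
  have hext : ∀ A B : H →L[ℂ] H, (∀ n x, A (V n x) = B (V n x)) → A = B := fun A B h =>
    ContinuousLinearMap.ext_of_total (fun n => V n) htot h
  have hnorm : ∀ a, ‖Φ a‖ ≤ ‖a‖ := fun a => by
    refine ContinuousLinearMap.opNorm_le_bound _ (norm_nonneg a) fun x => ?_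
    change ‖C.symm (lp.mapCLM 2 (fun _ : ℕ => a) (norm_nonneg a) (fun _ => le_rfl) (C x))‖ ≤ _
    rw [LinearIsometryEquiv.norm_map]
    refine (ContinuousLinearMap.le_of_opNorm_le _ (lp.norm_mapCLM_le _ _ _ _) _).trans ?_
    rw [LinearIsometryEquiv.norm_map]
  let Φ' : (H →L[ℂ] H) →+* (H →L[ℂ] H) :=
    { toFun := Φ
      map_one' := hext _ _ fun n x => by simp [hΦ]
      map_mul' := fun a b => hext _ _ fun n x => by simp [hΦ]
      map_zero' := hext _ _ fun n x => by simp [hΦ]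
      map_add' := fun a b => hext _ _ fun n x => by simp [hΦ] }
  exact ⟨Φ', AddMonoidHomClass.continuous_of_bound Φ' 1 fun a => by
    rw [one_mul]; exact hnorm a, hΦ⟩

end Amplification

namespace GHilbertStructure

namespace Decomposition

variable {G : Type*} [Group G] [TopologicalSpace G]
  {H : Type*} [NormedAddCommGroup H] [InnerProductSpace ℂ H] [CompleteSpace H]
  {π : GHilbertStructure G H} (D : π.Decomposition)

theorem ext {A B : H →L[ℂ] H} (h : ∀ p : D.ι × ℕ, ∀ v, A (D.J p.1 p.2 v) = B (D.J p.1 p.2 v)) :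
    A = B :=
  ContinuousLinearMap.ext_of_total (fun p : D.ι × ℕ => D.J p.1 p.2)
    (fun ξ hξ => D.total ξ fun i n v => hξ (i, n) v) h

theorem eq_zero_of_inner {A : H →L[ℂ] H}
    (h : ∀ p q : D.ι × ℕ, ∀ v w, ⟪A (D.J p.1 p.2 v), D.J q.1 q.2 w⟫_ℂ = 0) : A = 0 := by
  refine D.ext fun p v => ?_
  refine D.total _ fun i n w => ?_
  rw [← inner_conj_symm, h p (i, n), map_zero]

/-- An orthogonal system of copies of all summands defines an intertwining isometry. -/
theorem exists_isometry (L : ∀ p : D.ι × ℕ, D.K p.1 →ₗᵢ[ℂ] H) (hL : ∀ p, D.IsCombination (L p))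
    (horth : ∀ p q, p ≠ q → ∀ v w, ⟪L p v, L q w⟫_ℂ = 0) :
    ∃ R : H →ₗᵢ[ℂ] H, (∀ p v, R (D.J p.1 p.2 v) = L p v) ∧
      ∀ g x, R (π.op g x) = π.op g (R x) := by
  classical
  have hfam : OrthogonalFamily ℂ (fun p : D.ι × ℕ => D.K p.1) L :=
    fun p q hpq v w => horth p q hpq v w
  let R : H →ₗᵢ[ℂ] H := hfam.linearIsometry.comp D.coords.toLinearIsometry
  have hR : ∀ p v, R (D.J p.1 p.2 v) = L p v := fun p v => by
    change hfam.linearIsometry (D.coords (D.J p.1 p.2 v)) = _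
    rw [coords_J, hfam.linearIsometry_apply_single]
  refine ⟨R, hR, fun g x => ?_⟩
  have h : R.toContinuousLinearMap * π.op g = π.op g * R.toContinuousLinearMap :=
    D.ext fun p v => by
      change R (π.op g _) = π.op g (R _)
      rw [D.equivariant, hR p, hR p, (hL p).op_apply]
  exact congrArg (fun A : H →L[ℂ] H => A x) h

theorem isCombination_J (i : D.ι) (n : ℕ) : D.IsCombination (D.J i n) :=
  ⟨n + 1, fun j => if j = Fin.last n then 1 else 0, fun v => by simp⟩

/-- The intertwining isometry which permutes the copies of each summand. -/
theorem exists_reindex (f : ℕ → ℕ) (hf : Function.Injective f) :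
    ∃ R : H →ₗᵢ[ℂ] H, (∀ i n v, R (D.J i n v) = D.J i (f n) v) ∧
      ∀ g x, R (π.op g x) = π.op g (R x) := by
  obtain ⟨R, hR, hR'⟩ := D.exists_isometry (fun p => D.J p.1 (f p.2))
    (fun p => D.isCombination_J _ _) (fun p q hpq v w => D.orthogonal _ _ _ _ (fun h => hpq (by
      obtain ⟨h1, h2⟩ := Prod.mk.inj h
      exact Prod.ext h1 (hf h2))) v w)
  exact ⟨R, fun i n => hR (i, n), hR'⟩

/-- An operator is block diagonal if it maps the summands into mutually orthogonal subspaces. -/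
def IsBlockDiagonal (B : H →L[ℂ] H) : Prop :=
  ∀ p q : D.ι × ℕ, p ≠ q → ∀ v w, ⟪B (D.J p.1 p.2 v), D.J q.1 q.2 w⟫_ℂ = 0

end Decomposition

/-- Two intertwining isometries `v`, `s` with complementary ranges, and an equivariant amplification
`Φ` of operators which absorbs operators. -/
structure SwindleData {G : Type*} [Group G] [TopologicalSpace G]
    {H : Type*} [NormedAddCommGroup H] [InnerProductSpace ℂ H] [CompleteSpace H]
    (π : GHilbertStructure G H) where
  v : H →L[ℂ] H
  s : H →L[ℂ] H
  Φ : (H →L[ℂ] H) →+* (H →L[ℂ] H)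
  star_v_mul_v : star v * v = 1
  star_s_mul_s : star s * s = 1
  star_s_mul_v : star s * v = 0
  v_op : ∀ g, v * π.op g = π.op g * v
  s_op : ∀ g, s * π.op g = π.op g * s
  continuous_Φ : Continuous Φ
  Φ_eq : ∀ a, Φ a = v * a * star v + s * Φ a * star s
  Φ_conj : ∀ g a, Φ (π.op g * a * π.op g⁻¹) = π.op g * Φ a * π.op g⁻¹

namespace Decomposition

variable {G : Type*} [Group G] [TopologicalSpace G]
  {H : Type*} [NormedAddCommGroup H] [InnerProductSpace ℂ H] [CompleteSpace H]
  {π : GHilbertStructure G H} (D : π.Decomposition)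

/-- A pairing of `ℕ` with `ℕ × ℕ` splits `H` into copies `V n` of itself. Here `v` is `V 0`, `s`
shifts `V n` to `V (n + 1)`, and `Φ` repeats an operator on every copy. Since `v` and `s` send the
summands to disjoint sets of summands, block diagonal operators have no entry from `v` to `s`. -/
theorem exists_swindleData : ∃ S : π.SwindleData,
    ∀ B, D.IsBlockDiagonal B → star S.s * B * S.v = 0 := by
  choose V hV hVop using fun n : ℕ => D.exists_reindex (fun m => Nat.pair n m)
    (fun a b h => (Nat.pair_eq_pair.1 h).2)
  obtain ⟨s, hs, hsop⟩ := D.exists_reindex (fun k => Nat.pair (k.unpair.1 + 1) k.unpair.2)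
    (fun a b h => by
      have := Nat.pair_eq_pair.1 h
      rw [← Nat.pair_unpair a, ← Nat.pair_unpair b, this.2, Nat.succ_injective this.1])
  have hJV : ∀ i k v, D.J i k v = V k.unpair.1 (D.J i k.unpair.2 v) := fun i k v => by
    rw [hV, Nat.pair_unpair]
  have hVtot : ∀ ξ, (∀ n x, ⟪V n x, ξ⟫_ℂ = 0) → ξ = 0 := fun ξ hξ =>
    D.total ξ fun i k v => by rw [hJV, hξ]
  have hVorth : ∀ n m, n ≠ m → ∀ x y, ⟪V n x, V m y⟫_ℂ = 0 := by
    intro n m hnm x y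
    have h : star (V m).toContinuousLinearMap * (V n).toContinuousLinearMap = 0 := by
      refine D.eq_zero_of_inner fun p q a b => ?_
      change ⟪star (V m).toContinuousLinearMap (V n (D.J p.1 p.2 a)), _⟫_ℂ = 0
      rw [ContinuousLinearMap.star_apply_inner]
      change ⟪V n (D.J p.1 p.2 a), V m (D.J q.1 q.2 b)⟫_ℂ = 0
      rw [hV, hV]
      refine D.orthogonal _ _ _ _ (fun h => hnm ?_) _ _
      exact (Nat.pair_eq_pair.1 (Prod.mk.inj h).2).1
    have h1 := congrArg (fun A : H →L[ℂ] H => ⟪A x, y⟫_ℂ) h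
    simpa [ContinuousLinearMap.star_apply_inner] using h1
  obtain ⟨Φ, hΦc, hΦ⟩ := exists_amplification V hVorth hVtot
  have hsV : ∀ n x, s (V n x) = V (n + 1) x := by
    intro n x
    have h : s.toContinuousLinearMap * (V n).toContinuousLinearMap =
        (V (n + 1)).toContinuousLinearMap := D.ext fun p v => by
      change s (V n _) = V (n + 1) _
      simp [hV, hs]
    exact congrArg (fun A : H →L[ℂ] H => A x) h
  have hext : ∀ A B : H →L[ℂ] H, (∀ n x, A (V n x) = B (V n x)) → A = B := fun A B h =>
    ContinuousLinearMap.ext_of_total (fun n => V n) hVtot h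
  let v' := (V 0).toContinuousLinearMap
  let s' := s.toContinuousLinearMap
  have hv1 : ∀ x, v' x = V 0 x := fun x => rfl
  have hs1 : ∀ x, s' x = s x := fun x => rfl
  have hvv : star v' * v' = 1 := (V 0).star_mul_self
  have hss : star s' * s' = 1 := s.star_mul_self
  have hblock : ∀ B, D.IsBlockDiagonal B → star s' * B * v' = 0 := by
    intro B hB
    refine D.eq_zero_of_inner fun p q a b => ?_
    change ⟪star s' (B (V 0 _)), _⟫_ℂ = 0
    rw [ContinuousLinearMap.star_apply_inner, hs1, hV, hs]
    refine hB (p.1, Nat.pair 0 p.2) (q.1, Nat.pair (q.2.unpair.1 + 1) q.2.unpair.2) (fun h => ?_) _ _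
    have := (Nat.pair_eq_pair.1 (Prod.mk.inj h).2).1
    omega
  have hsv : star s' * v' = 0 := by
    have := hblock 1 fun p q hpq a b => D.orthogonal _ _ _ _ hpq a b
    simpa using this
  have hvs : star v' * s' = 0 := by
    have := congrArg star hsv
    simpa using this
  have happ : ∀ {A B : H →L[ℂ] H}, A = B → ∀ x, A x = B x := fun h x => by rw [h]
  have hsV' : ∀ n x, star s' (V (n + 1) x) = V n x := fun n x => by
    rw [← hsV]; exact happ hss _
  have hvV' : ∀ n x, star v' (V (n + 1) x) = 0 := fun n x => by
    rw [← hsV]; exact happ hvs _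
  refine ⟨{
    v := v'
    s := s'
    Φ := Φ
    star_v_mul_v := hvv
    star_s_mul_s := hss
    star_s_mul_v := hsv
    v_op := fun g => ContinuousLinearMap.ext fun x => hVop 0 g x
    s_op := fun g => ContinuousLinearMap.ext fun x => hsop g x
    continuous_Φ := hΦc
    Φ_eq := fun a => hext _ _ fun n x => ?_
    Φ_conj := fun g a => hext _ _ fun n x => ?_ }, hblock⟩
  · rw [hΦ]
    change _ = v' (a (star v' (V n x))) + s' (Φ a (star s' (V n x)))
    rcases n with - | n
    · have h1 : star v' (V 0 x) = x := happ hvv x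
      have h2 : star s' (V 0 x) = 0 := happ hsv x
      rw [h1, h2, map_zero, map_zero, add_zero]
      rfl
    · rw [hsV', hvV', map_zero, map_zero, zero_add, hΦ, hs1, hsV]
  · rw [hΦ]
    change V n (π.op g (a (π.op g⁻¹ x))) = π.op g (Φ a (π.op g⁻¹ (V n x)))
    rw [← hVop, hΦ, hVop]

end Decomposition

end GHilbertStructure

/-! ### Invariant partitions of unity indexed by chains of finite sets. -/

section OrbitMetric

/-- A copy of a metric `G`-space which carries the distance of orbits. -/
structure OrbitMetric (G X : Type*) where
  mk ::
  out : X

namespace OrbitMetric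

variable {G X : Type*} [Group G] [PseudoEMetricSpace X] [MulAction G X] [IsIsometricSMul G X]

/-- Points of one orbit get distance zero, so continuous functions into a Hausdorff space are
automatically invariant. A pseudodistance is enough for partitions of unity, and the quotient need
not be formed. -/
noncomputable instance : PseudoEMetricSpace (OrbitMetric G X) where
  edist x y := ⨅ g : G, edist x.out (g • y.out)
  edist_self x := le_antisymm (iInf_le_of_le 1 (by rw [one_smul, edist_self])) bot_le
  edist_comm x y := by
    refine Equiv.iInf_congr (Equiv.inv G) fun g => ?_
    rw [Equiv.inv_apply, edist_comm, ← edist_smul_left g, smul_inv_smul]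
  edist_triangle x y z := by
    simp only [ENNReal.iInf_add, ENNReal.add_iInf]
    refine le_iInf fun g => le_iInf fun h => iInf_le_of_le (h * g) ?_
    refine (edist_triangle _ (h • y.out) _).trans ?_
    rw [mul_smul, edist_smul_left]

theorem edist_def (x y : OrbitMetric G X) : edist x y = ⨅ g : G, edist x.out (g • y.out) := rfl

theorem continuous_mk : Continuous (mk : X → OrbitMetric G X) := by
  refine (LipschitzWith.of_edist_le fun x y => ?_ :
    LipschitzWith 1 (mk : X → OrbitMetric G X)).continuous
  rw [edist_def]
  exact iInf_le_of_le 1 (by rw [one_smul])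

theorem apply_smul {Y : Type*} [TopologicalSpace Y] [T2Space Y]
    {f : OrbitMetric G X → Y} (hf : Continuous f) (g : G) (x : X) :
    f (mk (g • x)) = f (mk x) := by
  have h : Inseparable (mk (g • x) : OrbitMetric G X) (mk x) := by
    rw [EMetric.inseparable_iff]
    refine le_antisymm ?_ bot_le
    rw [edist_def]
    exact iInf_le_of_le g (by rw [edist_self])
  exact (h.map hf).eq

end OrbitMetric

variable {G X : Type*} [Group G] [PseudoEMetricSpace X] [MulAction G X] [IsIsometricSMul G X]

/-- An invariant partition of unity whose members are indexed by finite sets of points close to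
the support, in such a way that members which meet are indexed by nested sets. -/
theorem exists_invariant_nested_partition {ε : ENNReal} (hε : 0 < ε) :
    ∃ c : Finset X → X → ℝ, (∀ A, Continuous (c A)) ∧
      (LocallyFinite fun A => Function.support (c A)) ∧ (∀ x, ∑ᶠ A, c A x ^ 2 = 1) ∧
      (∀ A (g : G) x, c A (g • x) = c A x) ∧
      (∀ A x, c A x ≠ 0 → ∀ a ∈ A, ∃ g : G, edist x (g • a) < ε) ∧
      (∀ A x, c A x ≠ 0 → A.Nonempty) ∧
      ∀ A B x, c A x ≠ 0 → c B x ≠ 0 → A ⊆ B ∨ B ⊆ A := by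
  classical
  obtain ⟨φ, hφ⟩ := PartitionOfUnity.exists_isSubordinate (X := OrbitMetric G X)
    (s := Set.univ) isClosed_univ (fun a : X => Metric.eball (.mk a : OrbitMetric G X) ε)
    (fun a => Metric.isOpen_eball) fun x _ => Set.mem_iUnion.2 ⟨x.out, Metric.mem_eball_self hε⟩
  let f : X → X → ℝ := fun a x => φ a (.mk x)
  have hfc : ∀ a, Continuous (f a) := fun a => (φ a).continuous.comp OrbitMetric.continuous_mk
  have hf0 : ∀ a x, 0 ≤ f a x := fun a x => φ.nonneg a _
  have hfg : ∀ a (g : G) x, f a (g • x) = f a x := fun a g x =>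
    OrbitMetric.apply_smul (φ a).continuous g x
  have hflf : LocallyFinite fun a => Function.support (f a) :=
    φ.locallyFinite.preimage_continuous OrbitMetric.continuous_mk
  have hsum : ∀ x, ∑ᶠ a, f a x = 1 := fun x => φ.sum_eq_one (Set.mem_univ _)
  have hfin : ∀ x, (Function.support fun a => f a x).Finite := fun x => hflf.point_finite x
  have hle : ∀ (A : Finset X) x, ∑ a ∈ A, f a x ≤ 1 := fun A x => by
    rw [← hsum x, finsum_eq_sum_of_support_subset (s := (hfin x).toFinset ∪ A) _
      (fun a ha => by simpa using Or.inl ha)]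
    exact Finset.sum_le_sum_of_subset_of_nonneg Finset.subset_union_right fun a _ _ => hf0 a x
  have hfball : ∀ a x, f a x ≠ 0 → ∃ g : G, edist x (g • a) < ε := by
    intro a x h
    have h1 : OrbitMetric.mk x ∈ Metric.eball (.mk a : OrbitMetric G X) ε :=
      hφ a (subset_tsupport _ h)
    rw [Metric.mem_eball, OrbitMetric.edist_def, iInf_lt_iff] at h1
    exact h1
  -- This plays the part of a barycentric subdivision of the nerve: `ψ A` is nonzero only where each
  -- member of `A` outweighs the total weight missing from `A`.
  let ψ : Finset X → X → ℝ := fun A x =>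
    if h : A.Nonempty then max 0 (A.inf' h (fun a => f a x) + ∑ a ∈ A, f a x - 1) else 0
  have hψc : ∀ A, Continuous (ψ A) := by
    intro A
    by_cases h : A.Nonempty
    · simp only [ψ, h, dite_true]
      have h1 : Continuous fun x => A.inf' h (fun a => f a x) :=
        Continuous.finset_inf'_apply h fun a _ => hfc a
      have h2 : Continuous fun x => ∑ a ∈ A, f a x := continuous_finsetSum _ fun a _ => hfc a
      exact continuous_const.max ((h1.add h2).sub continuous_const)
    · simp only [ψ, h, dite_false]
      exact continuous_const
  have hψ0 : ∀ A x, 0 ≤ ψ A x := by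
    intro A x
    by_cases h : A.Nonempty
    · simp [ψ, h]
    · simp [ψ, h]
  have hψne : ∀ A x, ψ A x ≠ 0 → A.Nonempty ∧ ∀ a ∈ A, 1 < f a x + ∑ b ∈ A, f b x := by
    intro A x hA
    by_cases h : A.Nonempty
    · refine ⟨h, fun a ha => ?_⟩
      simp only [ψ, h, dite_true] at hA
      have h1 : 0 < A.inf' h (fun a => f a x) + ∑ a ∈ A, f a x - 1 := by
        by_contra h2
        exact hA (max_eq_left (not_lt.1 h2))
      have h2 : A.inf' h (fun a => f a x) ≤ f a x := Finset.inf'_le _ ha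
      linarith
    · simp [ψ, h] at hA
  have hψf : ∀ A x, ψ A x ≠ 0 → ∀ a ∈ A, f a x ≠ 0 := by
    intro A x hA a ha h0
    have h1 := (hψne A x hA).2 a ha
    have h2 := hle A x
    rw [h0] at h1
    linarith
  have hψg : ∀ A (g : G) x, ψ A (g • x) = ψ A x := fun A g x => by simp only [ψ, hfg]
  have hψlf : LocallyFinite fun A => Function.support (ψ A) := by
    intro x
    obtain ⟨t, ht, htf⟩ := hflf x
    refine ⟨t, ht, (htf.toFinset.powerset.finite_toSet).subset ?_⟩
    rintro A ⟨y, hy, hyt⟩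
    rw [Finset.mem_coe, Finset.mem_powerset]
    intro a ha
    rw [Set.Finite.mem_toFinset]
    exact ⟨y, hψf A y hy a ha, hyt⟩
  have hψpos : ∀ x, ∃ A, 0 < ψ A x := by
    intro x
    let A := (hfin x).toFinset
    have hA : ∑ a ∈ A, f a x = 1 := by
      rw [← hsum x, finsum_eq_sum_of_support_subset (s := A) _ (fun a ha => by simpa [A] using ha)]
    have hne : A.Nonempty := by
      by_contra h
      rw [Finset.not_nonempty_iff_eq_empty] at h
      simp [h] at hA
    refine ⟨A, ?_⟩
    have : 0 < A.inf' hne (fun a => f a x) := by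
      rw [Finset.lt_inf'_iff]
      intro a ha
      exact lt_of_le_of_ne (hf0 a x) (Ne.symm (by simpa [A] using ha))
    have h2 : ψ A x = max 0 (A.inf' hne (fun a => f a x) + ∑ a ∈ A, f a x - 1) := dif_pos hne
    rw [h2, hA]
    exact lt_max_of_lt_right (by linarith)
  -- The squares are normalised, so that the coefficients later combine orthogonal isometries into
  -- an isometry.
  let N : X → ℝ := fun x => ∑ᶠ A, ψ A x ^ 2
  have hψfin : ∀ x, (Function.support fun A => ψ A x ^ 2).Finite := fun x =>
    (hψlf.point_finite x).subset fun A hA h0 => hA (by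
      have h1 : ψ A x = 0 := h0
      simp [h1])
  have hNc : Continuous N := by
    refine continuous_finsum (fun A => (hψc A).pow 2) ?_
    refine hψlf.subset fun A x hx h0 => hx ?_
    simp [h0]
  have hNpos : ∀ x, 0 < N x := by
    intro x
    obtain ⟨A, hA⟩ := hψpos x
    exact finsum_pos (fun A => sq_nonneg _) ⟨A, by positivity⟩ (hψfin x)
  have hne : ∀ A x, ψ A x / Real.sqrt (N x) ≠ 0 → ψ A x ≠ 0 := fun A x h h0 =>
    h (by rw [h0, zero_div])
  refine ⟨fun A x => ψ A x / Real.sqrt (N x), fun A => ?_, ?_, fun x => ?_, fun A g x => ?_,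
    fun A x h a ha => hfball a x (hψf A x (hne A x h) a ha), fun A x h => (hψne A x (hne A x h)).1,
    fun A B x hA hB => ?_⟩
  · exact (hψc A).div (Real.continuous_sqrt.comp hNc) fun x => (Real.sqrt_pos.2 (hNpos x)).ne'
  · exact hψlf.subset fun A x hx => hne A x hx
  · have h1 : ∀ A, (ψ A x / Real.sqrt (N x)) ^ 2 = ψ A x ^ 2 * (N x)⁻¹ := fun A => by
      rw [div_pow, Real.sq_sqrt (hNpos x).le, div_eq_mul_inv]
    simp only [h1]
    rw [← finsum_mul' _ _ (hψfin x)]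
    exact mul_inv_cancel₀ (hNpos x).ne'
  · simp only [N, hψg]
  -- With `a` in `A` only and `b` in `B` only, `a` outweighs what `A` misses, hence `b`, and `b`
  -- likewise outweighs `a`.
  · by_contra! h
    obtain ⟨a, haA, haB⟩ := Finset.not_subset.1 h.1
    obtain ⟨b, hbB, hbA⟩ := Finset.not_subset.1 h.2
    have h1 := (hψne A x (hne A x hA)).2 a haA
    have h2 := (hψne B x (hne B x hB)).2 b hbB
    have h3 := hle (insert b A) x
    have h4 := hle (insert a B) x
    rw [Finset.sum_insert hbA] at h3
    rw [Finset.sum_insert haB] at h4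
    linarith

end OrbitMetric

/-! ### Kuiper isometries for all finite sets of operators. -/

namespace GHilbertStructure

namespace Decomposition

variable {G : Type*} [Group G] [TopologicalSpace G]
  {H : Type*} [NormedAddCommGroup H] [InnerProductSpace ℂ H] [CompleteSpace H]
  {π : GHilbertStructure G H} (D : π.Decomposition)

/-- A family of intertwining isometries indexed by the finite subsets of a family of operators, such
that all isometries indexed by a chain have mutually orthogonal ranges, even after an application of
the operators in the smallest set. -/
theorem exists_isometry_family {α : Type*} (u : α → H →L[ℂ] H) :
    ∃ R : Finset α → H →L[ℂ] H, (∀ A, star (R A) * R A = 1) ∧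
      (∀ A g, R A * π.op g = π.op g * R A) ∧
      (∀ A B, A ⊆ B ∨ B ⊆ A → A ≠ B → star (R A) * R B = 0) ∧
      (∀ A B, A ⊆ B ∨ B ⊆ A → A ≠ B → ∀ a ∈ A, a ∈ B → star (R A) * u a * R B = 0) ∧
      ∀ A, ∀ a ∈ A, D.IsBlockDiagonal (star (R A) * u a * R A) := by
  classical
  -- The identity is included to make the ranges themselves orthogonal, the adjoints to make the
  -- orthogonality relations symmetric.
  let U : Finset α → Finset (H →L[ℂ] H) := fun A =>
    insert 1 (A.image u ∪ A.image fun a => star (u a))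
  have hUstar : ∀ A, ∀ w ∈ U A, ContinuousLinearMap.adjoint w ∈ U A := by
    intro A w hw
    rw [← ContinuousLinearMap.star_eq_adjoint]
    simp only [U, Finset.mem_insert, Finset.mem_union, Finset.mem_image] at hw ⊢
    rcases hw with rfl | ⟨a, ha, rfl⟩ | ⟨a, ha, rfl⟩
    · exact Or.inl (star_one _)
    · exact Or.inr (Or.inr ⟨a, ha, rfl⟩)
    · exact Or.inr (Or.inl ⟨a, ha, (star_star _).symm⟩)
  let E : ∀ (_ : Finset α) (_ : ∀ p : D.ι × ℕ, D.K p.1 →ₗᵢ[ℂ] H), Submodule ℂ H := fun A L =>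
    ⨆ w ∈ U A, ⨆ p, (LinearMap.range (L p).toLinearMap).map w.toLinearMap
  let β : Finset α → Type _ := fun A => {L : ∀ p : D.ι × ℕ, D.K p.1 →ₗᵢ[ℂ] H //
    (∀ p, D.IsCombination (L p)) ∧
    (∀ w ∈ U A, ∀ p q, p ≠ q → ∀ x y, ⟪w (L p x), L q y⟫_ℂ = 0) ∧ D.IsThin (E A L)}
  have hβ : ∀ A, Nonempty (β A) := by
    intro A
    obtain ⟨L, h1, -, h2, h3⟩ := D.exists_thin_family (U A) (hUstar A)
      (D.isThin_of_finiteDimensional ⊥)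
    exact ⟨⟨L, h1, h2, h3⟩⟩
  -- Recursion on the cardinality: the system for `A` avoids the images of the systems for its
  -- proper subsets. These images are infinite dimensional in general, and thinness is what makes
  -- them avoidable.
  obtain ⟨L, hL⟩ := exists_forall_of_rank (β := β) Finset.card
    (fun A f x => ∀ B ⊂ A, ∀ w ∈ U B, ∀ p q v y, ⟪w ((f B).1 p v), x.1 q y⟫_ℂ = 0)
    (fun A f f' x hff h B hB w hw => by
      rw [← hff B (Finset.card_lt_card hB)]; exact h B hB w hw)
    (fun A f => by
      obtain ⟨L, h1, h2, h3, h4⟩ := D.exists_thin_family (U A) (hUstar A)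
        (IsThin.biSup A.ssubsets (Z := fun B => E B (f B).1) fun B _ => (f B).2.2.2)
      refine ⟨⟨L, h1, h3, h4⟩, fun B hB w hw p q v y => h2 q _ ?_ y⟩
      refine Submodule.mem_iSup_of_mem B (Submodule.mem_iSup_of_mem
        (Finset.mem_ssubsets.2 hB) ?_)
      exact Submodule.mem_iSup_of_mem w (Submodule.mem_iSup_of_mem hw
        (Submodule.mem_iSup_of_mem p ⟨_, ⟨v, rfl⟩, rfl⟩)))
  have hone : ∀ A, (1 : H →L[ℂ] H) ∈ U A := fun A => Finset.mem_insert_self _ _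
  have hmem : ∀ A, ∀ a ∈ A, u a ∈ U A := fun A a ha =>
    Finset.mem_insert_of_mem (Finset.mem_union_left _ (Finset.mem_image_of_mem _ ha))
  choose R hR hRop using fun A => D.exists_isometry (L A).1 (L A).2.1
    ((L A).2.2.1 1 (hone A))
  have hcross : ∀ A B, B ⊂ A → ∀ w ∈ U B,
      star (R A).toContinuousLinearMap * w * (R B).toContinuousLinearMap = 0 := by
    intro A B hB w hw
    refine D.eq_zero_of_inner fun p q v y => ?_
    change ⟪star (R A).toContinuousLinearMap (w (R B _)), _⟫_ℂ = 0
    rw [ContinuousLinearMap.star_apply_inner, hR]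
    change ⟪w ((L B).1 p v), R A _⟫_ℂ = 0
    rw [hR]
    exact hL A B hB w hw p q v y
  have hcross' : ∀ A B, A ⊂ B → ∀ w ∈ U A,
      star (R A).toContinuousLinearMap * w * (R B).toContinuousLinearMap = 0 := by
    intro A B hB w hw
    have h := congrArg star (hcross B A hB _ (hUstar A w hw))
    rw [← ContinuousLinearMap.star_eq_adjoint] at h
    simpa [mul_assoc] using h
  refine ⟨fun A => (R A).toContinuousLinearMap, fun A => (R A).star_mul_self, fun A g =>
    ContinuousLinearMap.ext fun x => hRop A g x, fun A B h hne => ?_, fun A B h hne a ha hb => ?_,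
    fun A a ha p q hpq v y => ?_⟩
  · rcases h with h | h
    · simpa using hcross' A B (h.ssubset_of_ne hne) 1 (hone A)
    · simpa using hcross A B (h.ssubset_of_ne hne.symm) 1 (hone B)
  · rcases h with h | h
    · exact hcross' A B (h.ssubset_of_ne hne) _ (hmem A a ha)
    · exact hcross A B (h.ssubset_of_ne hne.symm) _ (hmem B a hb)
  · change ⟪star (R A).toContinuousLinearMap (u a (R A _)), _⟫_ℂ = 0
    rw [ContinuousLinearMap.star_apply_inner, hR]
    change ⟪_, R A _⟫_ℂ = 0
    rw [hR]
    exact (L A).2.2.1 _ (hmem A a ha) p q hpq v y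

end Decomposition

end GHilbertStructure

/-! ### Continuous invariant sections moved almost orthogonally. -/

namespace GHilbertStructure

variable {G : Type*} [Group G] [TopologicalSpace G]
  {H : Type*} [NormedAddCommGroup H] [InnerProductSpace ℂ H] [CompleteSpace H]
  {π : GHilbertStructure G H}

theorem op_mul_op_inv (g : G) : π.op g * π.op g⁻¹ = 1 := by
  rw [← op_mul, mul_inv_cancel, op_one]

theorem star_op (g : G) : star (π.op g) = π.op g⁻¹ := by
  simp only [op, map_inv]
  rfl

/-- The adjoint of an intertwiner is an intertwiner. -/
theorem star_mul_op {R : H →L[ℂ] H} (hR : ∀ g, R * π.op g = π.op g * R) (g : G) :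
    star R * π.op g = π.op g * star R := by
  have h := congrArg star (hR g⁻¹)
  simpa [star_op] using h.symm

/-- The operator underlying a `G`-continuous unitary operator. -/
abbrev toOp (x : π.unitaryGCts) : H →L[ℂ] H := ((x : unitary (H →L[ℂ] H)) : H →L[ℂ] H)

theorem continuous_toOp : Continuous (toOp : π.unitaryGCts → H →L[ℂ] H) :=
  continuous_subtype_val.comp continuous_subtype_val

theorem norm_op_mul (g : G) (a : H →L[ℂ] H) : ‖π.op g * a‖ = ‖a‖ :=
  CStarRing.norm_coe_unitary_mul _ _

theorem norm_mul_op (g : G) (a : H →L[ℂ] H) : ‖a * π.op g‖ = ‖a‖ :=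
  CStarRing.norm_mul_coe_unitary _ _

variable [IsTopologicalGroup G]

theorem toOp_smul (g : G) (x : π.unitaryGCts) :
    toOp (g • x) = π.op g * toOp x * π.op g⁻¹ := by
  simp only [op, map_inv]
  rfl

instance : IsIsometricSMul G π.unitaryGCts where
  isometry_smul g := by
    refine Isometry.of_dist_eq fun x y => ?_
    change dist (toOp (g • x)) (toOp (g • y)) = dist (toOp x) (toOp y)
    rw [dist_eq_norm, toOp_smul, toOp_smul, ← sub_mul, ← mul_sub,
      norm_mul_op, norm_op_mul, dist_eq_norm]

theorem norm_le_one_of_star_mul_self {R : H →L[ℂ] H} (h : star R * R = 1) : ‖R‖ ≤ 1 := by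
  refine ContinuousLinearMap.opNorm_le_bound _ zero_le_one fun x => ?_
  have h1 : ⟪R x, R x⟫_ℂ = ⟪x, x⟫_ℂ := by
    rw [← ContinuousLinearMap.star_apply_inner]
    exact congrArg (fun A : H →L[ℂ] H => ⟪A x, x⟫_ℂ) h
  rw [inner_self_eq_norm_sq_to_K, inner_self_eq_norm_sq_to_K] at h1
  have h2 : ‖R x‖ ^ 2 = ‖x‖ ^ 2 := by exact_mod_cast h1
  rw [one_mul, (sq_eq_sq₀ (norm_nonneg _) (norm_nonneg _)).1 h2]

/-- Two families of intertwining isometries with orthogonal ranges, depending continuously and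
invariantly on a `G`-continuous unitary operator, such that the operator maps the range of one of
them almost orthogonally to the other. -/
theorem exists_almost_orthogonal_sections (D : π.Decomposition) (W : π.SwindleData)
    (hW : ∀ B, D.IsBlockDiagonal B → star W.s * B * W.v = 0) :
    ∃ S T : π.unitaryGCts → H →L[ℂ] H, Continuous S ∧ Continuous T ∧
      (∀ (g : G) x, S (g • x) = S x) ∧ (∀ (g : G) x, T (g • x) = T x) ∧
      (∀ x g, S x * π.op g = π.op g * S x) ∧ (∀ x g, T x * π.op g = π.op g * T x) ∧
      (∀ x, star (S x) * S x = 1) ∧ (∀ x, star (T x) * T x = 1) ∧ (∀ x, star (T x) * S x = 0) ∧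
      ∀ x, ‖star (T x) * toOp x * S x‖ ≤ 1 / 2 := by
  classical
  obtain ⟨c, hcc, hclf, hcsum, hcg, hcdist, hcne, hcchain⟩ :=
    exists_invariant_nested_partition (G := G) (X := π.unitaryGCts)
      (ε := ENNReal.ofReal (1 / 2)) (by simp)
  obtain ⟨R, hR1, hRop, hRorth, hRcross, hRblock⟩ :=
    D.exists_isometry_family (toOp : π.unitaryGCts → H →L[ℂ] H)
  -- At each point only a chain of sets contributes, so the isometries involved have orthogonal
  -- ranges, and `Q x` is an isometry because the squared coefficients sum to `1`.
  let Q : π.unitaryGCts → H →L[ℂ] H := fun x => ∑ᶠ A, ((c A x : ℝ) : ℂ) • R A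
  have hQc : Continuous Q := by
    refine continuous_finsum (fun A => ?_) ?_
    · exact (Complex.continuous_ofReal.comp (hcc A)).smul continuous_const
    · refine hclf.subset fun A x hx h0 => hx ?_
      simp only [show c A x = 0 from h0, Complex.ofReal_zero, zero_smul]
  have hQg : ∀ (g : G) x, Q (g • x) = Q x := fun g x => by simp only [Q, hcg]
  let F : π.unitaryGCts → Finset (Finset π.unitaryGCts) := fun x => (hclf.point_finite x).toFinset
  have hF : ∀ x A, A ∈ F x ↔ c A x ≠ 0 := fun x A => by simp [F]
  have hQ : ∀ x, Q x = ∑ A ∈ F x, ((c A x : ℝ) : ℂ) • R A := fun x =>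
    finsum_eq_sum_of_support_subset _ fun A hA => (hF x A).2 fun h0 => hA (by simp [h0])
  have hsum : ∀ x, ∑ A ∈ F x, ((c A x : ℝ) : ℂ) * ((c A x : ℝ) : ℂ) = 1 := fun x => by
    have h1 := hcsum x
    rw [finsum_eq_sum_of_support_subset (s := F x) _
      (fun A hA => (hF x A).2 fun h0 => hA (by simp [h0]))] at h1
    rw [← Complex.ofReal_one, ← h1, Complex.ofReal_sum]
    exact Finset.sum_congr rfl fun A _ => by rw [← Complex.ofReal_mul, sq]
  have hQop : ∀ x g, Q x * π.op g = π.op g * Q x := fun x g => by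
    simp only [hQ, Finset.sum_mul, Finset.mul_sum, smul_mul_assoc, mul_smul_comm, hRop]
  have hexp : ∀ x (B : H →L[ℂ] H),
      (∀ A ∈ F x, ∀ A' ∈ F x, A ≠ A' → star (R A) * B * R A' = 0) →
      star (Q x) * B * Q x = ∑ A ∈ F x, (((c A x : ℝ) : ℂ) * ((c A x : ℝ) : ℂ)) •
        (star (R A) * B * R A) := by
    intro x B hB
    rw [hQ, star_sum, Finset.sum_mul, Finset.sum_mul]
    refine Finset.sum_congr rfl fun A hA => ?_
    rw [Finset.mul_sum, Finset.sum_eq_single_of_mem A hA]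
    · rw [star_smul, smul_mul_assoc, smul_mul_assoc, mul_smul_comm, smul_smul]
      simp
    · intro A' hA' hne
      rw [star_smul, smul_mul_assoc, smul_mul_assoc, mul_smul_comm, hB A hA A' hA' hne.symm,
        smul_zero, smul_zero]
  have hchain : ∀ x, ∀ A ∈ F x, ∀ A' ∈ F x, A ⊆ A' ∨ A' ⊆ A := fun x A hA A' hA' =>
    hcchain A A' x ((hF x A).1 hA) ((hF x A').1 hA')
  have hQ1 : ∀ x, star (Q x) * Q x = 1 := fun x => by
    have h := hexp x 1 fun A hA A' hA' hne => by
      rw [mul_one, hRorth A A' (hchain x A hA A' hA') hne]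
    simp only [mul_one, hR1, ← Finset.sum_smul, hsum, one_smul] at h
    exact h
  have hmulop : ∀ {A B : H →L[ℂ] H}, (∀ g, A * π.op g = π.op g * A) →
      (∀ g, B * π.op g = π.op g * B) → ∀ g, A * B * π.op g = π.op g * (A * B) := by
    intro A B hA hB g
    rw [mul_assoc, hB, ← mul_assoc, hA, mul_assoc]
  have hS1 : ∀ {r : H →L[ℂ] H}, star r * r = 1 → ∀ x, star (Q x * r) * (Q x * r) = 1 :=
    fun {r} hr x => by
      rw [star_mul, mul_assoc, ← mul_assoc (star (Q x)), hQ1, one_mul, hr]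
  refine ⟨fun x => Q x * W.v, fun x => Q x * W.s, hQc.mul continuous_const,
    hQc.mul continuous_const, fun (g : G) x => by simp only [hQg], fun (g : G) x => by simp only [hQg],
    fun x => hmulop (hQop x) W.v_op, fun x => hmulop (hQop x) W.s_op, hS1 W.star_v_mul_v,
    hS1 W.star_s_mul_s, fun x => ?_, fun x => ?_⟩
  · rw [star_mul, mul_assoc, ← mul_assoc (star (Q x)), hQ1, one_mul, W.star_s_mul_v]
  · have hFne : (F x).Nonempty := by
      by_contra h
      rw [Finset.not_nonempty_iff_eq_empty] at h
      have := hsum x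
      simp [h] at this
    -- A point `a` of the smallest set of the chain lies in every contributing set, so all
    -- off-diagonal terms for `toOp a` vanish and the diagonal ones are block diagonal.
    obtain ⟨A₀, hA₀, hmin⟩ := (F x).exists_min_image Finset.card hFne
    have hsub : ∀ A ∈ F x, A₀ ⊆ A := fun A hA => by
      rcases hchain x A₀ hA₀ A hA with h | h
      · exact h
      · exact (Finset.eq_of_subset_of_card_le h (hmin A hA)).symm.subset
    obtain ⟨a, ha⟩ := hcne A₀ x ((hF x A₀).1 hA₀)
    obtain ⟨g, hg⟩ := hcdist A₀ x ((hF x A₀).1 hA₀) a ha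
    have hdist : ‖toOp x - π.op g * toOp a * π.op g⁻¹‖ ≤ 1 / 2 := by
      rw [edist_dist, ENNReal.ofReal_lt_ofReal_iff (by norm_num)] at hg
      rw [← toOp_smul, ← dist_eq_norm]
      exact hg.le
    have hzero : star (Q x * W.s) * toOp a * (Q x * W.v) = 0 := by
      have h1 : star (Q x * W.s) * toOp a * (Q x * W.v) =
          star W.s * (star (Q x) * toOp a * Q x) * W.v := by
        simp only [star_mul, mul_assoc]
      rw [h1, hexp x (toOp a) fun A hA A' hA' hne => hRcross A A' (hchain x A hA A' hA') hne a
        (hsub A hA ha) (hsub A' hA' ha), Finset.mul_sum, Finset.sum_mul]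
      refine Finset.sum_eq_zero fun A hA => ?_
      rw [mul_smul_comm, smul_mul_assoc, hW _ (hRblock A a (hsub A hA ha)), smul_zero]
    -- The sections intertwine, so orthogonality for `a` passes to its conjugates; it is enough that
    -- `x` be close to the orbit of `a`.
    have hconj : star (Q x * W.s) * (π.op g * toOp a * π.op g⁻¹) * (Q x * W.v) = 0 := by
      have h1 := star_mul_op (hmulop (hQop x) W.s_op) g
      have h2 := hmulop (hQop x) W.v_op g⁻¹
      calc _ = (star (Q x * W.s) * π.op g) * toOp a * (π.op g⁻¹ * (Q x * W.v)) := by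
            simp only [mul_assoc]
        _ = π.op g * (star (Q x * W.s) * toOp a * (Q x * W.v)) * π.op g⁻¹ := by
            rw [h1, ← h2]; simp only [mul_assoc]
        _ = 0 := by rw [hzero, mul_zero, zero_mul]
    have hsplit : star (Q x * W.s) * toOp x * (Q x * W.v) =
        star (Q x * W.s) * (toOp x - π.op g * toOp a * π.op g⁻¹) * (Q x * W.v) := by
      rw [mul_sub, sub_mul, hconj, sub_zero]
    rw [hsplit]
    have hn1 : ‖star (Q x * W.s)‖ ≤ 1 := by
      rw [norm_star]; exact norm_le_one_of_star_mul_self (hS1 W.star_s_mul_s x)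
    have hn2 : ‖Q x * W.v‖ ≤ 1 := norm_le_one_of_star_mul_self (hS1 W.star_v_mul_v x)
    calc _ ≤ ‖star (Q x * W.s)‖ * ‖toOp x - π.op g * toOp a * π.op g⁻¹‖ * ‖Q x * W.v‖ :=
          (norm_mul_le _ _).trans (mul_le_mul_of_nonneg_right (norm_mul_le _ _) (norm_nonneg _))
      _ ≤ 1 * (1 / 2) * 1 := by gcongr
      _ = 1 / 2 := by norm_num

end GHilbertStructure

end Sections

/-! ### The Whitehead lemma and the Eilenberg swindle in a ring. -/

section AbstractSwindle

variable {C : Type*} [Ring C] (N : Subgroup Cˣ)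

/-- The quarter turn in the plane spanned by two copies of a module. -/
def quarterTurn {P K : C} (hP : P * P = P) (hPK : P * K = K) (hKP : K * P = K)
    (hK : K * K = -P) : Cˣ where
  val := 1 - P + K
  inv := 1 - P - K
  val_inv := by
    have : (1 - P + K) * (1 - P - K) = 1 - P - P + P * P - K * K + P * K - K * P := by noncomm_ring
    rw [this, hP, hPK, hKP, hK]; noncomm_ring
  inv_val := by
    have : (1 - P - K) * (1 - P + K) = 1 - P - P + P * P - K * K - P * K + K * P := by noncomm_ring
    rw [this, hP, hPK, hKP, hK]; noncomm_ring

/-- A normal subgroup of units is large if it contains all quarter turns and all unipotents. -/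
structure ContainsElementary : Prop where
  normal : N.Normal
  quarterTurn_mem : ∀ {P K : C} (hP : P * P = P) (hPK : P * K = K) (hKP : K * P = K)
    (hK : K * K = -P), quarterTurn hP hPK hKP hK ∈ N
  unipotent_mem : ∀ (w : Cˣ) (n : C), n * n = 0 → (w : C) = 1 - n → w ∈ N

variable {N}

/-- The quarter turn exchanging two copies of a module, in terms of the inclusions `x₀`, `x₁` and the
projections `l₀`, `l₁`. -/
theorem ContainsElementary.exists_turn (hN : ContainsElementary N) {q x₀ l₀ x₁ l₁ : C}
    (h00 : l₀ * x₀ = q) (h01 : l₀ * x₁ = 0) (h10 : l₁ * x₀ = 0) (h11 : l₁ * x₁ = q)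
    (hx0 : x₀ * q = x₀) (hx1 : x₁ * q = x₁) (hl0 : q * l₀ = l₀) (hl1 : q * l₁ = l₁) :
    ∃ w ∈ N, (w : C) * x₀ = x₁ ∧ (w : C) * x₁ = -x₀ ∧ l₀ * ((w⁻¹ : Cˣ) : C) = l₁ ∧
      l₁ * ((w⁻¹ : Cˣ) : C) = -l₀ := by
  have a00 : ∀ z, l₀ * (x₀ * z) = q * z := fun z => by rw [← mul_assoc, h00]
  have a01 : ∀ z, l₀ * (x₁ * z) = 0 := fun z => by rw [← mul_assoc, h01, zero_mul]
  have a10 : ∀ z, l₁ * (x₀ * z) = 0 := fun z => by rw [← mul_assoc, h10, zero_mul]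
  have a11 : ∀ z, l₁ * (x₁ * z) = q * z := fun z => by rw [← mul_assoc, h11]
  have hP : (x₀ * l₀ + x₁ * l₁) * (x₀ * l₀ + x₁ * l₁) = x₀ * l₀ + x₁ * l₁ := by
    simp only [mul_add, add_mul, mul_assoc, a00, a01, a10, a11, hl0, hl1, mul_zero, add_zero,
      zero_add]
  have hPK : (x₀ * l₀ + x₁ * l₁) * (x₁ * l₀ - x₀ * l₁) = x₁ * l₀ - x₀ * l₁ := by
    simp only [mul_sub, add_mul, mul_assoc, a00, a01, a10, a11, hl0, hl1, mul_zero, add_zero,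
      zero_add]
  have hKP : (x₁ * l₀ - x₀ * l₁) * (x₀ * l₀ + x₁ * l₁) = x₁ * l₀ - x₀ * l₁ := by
    simp only [mul_add, sub_mul, mul_assoc, a00, a01, a10, a11, hl0, hl1, mul_zero, sub_zero,
      zero_sub]
    abel
  have hK : (x₁ * l₀ - x₀ * l₁) * (x₁ * l₀ - x₀ * l₁) = -(x₀ * l₀ + x₁ * l₁) := by
    simp only [mul_sub, sub_mul, mul_assoc, a00, a01, a10, a11, hl0, hl1, mul_zero, sub_zero,
      zero_sub]
    abel
  refine ⟨quarterTurn hP hPK hKP hK, hN.quarterTurn_mem hP hPK hKP hK, ?_, ?_, ?_, ?_⟩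
  · change (1 - (x₀ * l₀ + x₁ * l₁) + (x₁ * l₀ - x₀ * l₁)) * x₀ = x₁
    simp only [add_mul, sub_mul, mul_assoc, h00, h10, hx0, hx1, mul_zero, one_mul]
    abel
  · change (1 - (x₀ * l₀ + x₁ * l₁) + (x₁ * l₀ - x₀ * l₁)) * x₁ = -x₀
    simp only [add_mul, sub_mul, mul_assoc, h01, h11, hx0, hx1, mul_zero, one_mul]
    abel
  · change l₀ * (1 - (x₀ * l₀ + x₁ * l₁) - (x₁ * l₀ - x₀ * l₁)) = l₁
    simp only [mul_add, mul_sub, a00, a01, hl0, hl1, mul_one]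
    abel
  · change l₁ * (1 - (x₀ * l₀ + x₁ * l₁) - (x₁ * l₀ - x₀ * l₁)) = -l₀
    simp only [mul_add, mul_sub, a10, a11, hl0, hl1, mul_one]
    abel

/-- The Whitehead lemma: a unit on one copy of a module and its inverse on another copy. -/
theorem ContainsElementary.exists_whitehead (hN : ContainsElementary N) {q x₀ l₀ x₁ l₁ : C}
    (h00 : l₀ * x₀ = q) (h01 : l₀ * x₁ = 0) (h10 : l₁ * x₀ = 0) (h11 : l₁ * x₁ = q)
    (hx0 : x₀ * q = x₀) (hx1 : x₁ * q = x₁) (hl0 : q * l₀ = l₀) (hl1 : q * l₁ = l₁)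
    {y y' : C} (hyy' : y * y' = 1) (hy'y : y' * y = 1) (hqy : q * y = y * q)
    (hqy' : q * y' = y' * q) :
    ∃ w ∈ N, (w : C) = 1 + x₀ * (y' - 1) * l₀ + x₁ * (y - 1) * l₁ := by
  obtain ⟨w, hwN, hw0, hw1, hw0', hw1'⟩ := hN.exists_turn h00 h01 h10 h11 hx0 hx1 hl0 hl1
  have key : ∀ z z' : C, z * z' = 1 → q * z = z * q →
      (1 + x₁ * (z - 1) * l₁) * (1 + x₁ * (z' - 1) * l₁) = 1 := by
    intro z z' hz hq
    have h1 : x₁ * (z - 1) * l₁ * (x₁ * (z' - 1) * l₁) =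
        x₁ * ((z - 1) * (z' - 1)) * l₁ := by
      calc _ = x₁ * ((z - 1) * (l₁ * x₁)) * (z' - 1) * l₁ := by simp only [mul_assoc]
        _ = x₁ * (q * (z - 1)) * (z' - 1) * l₁ := by
          rw [h11, show (z - 1) * q = q * (z - 1) by rw [sub_mul, mul_sub, hq, one_mul, mul_one]]
        _ = _ := by rw [← mul_assoc x₁ q, hx1]; simp only [mul_assoc]
    have h2 : (z - 1) * (z' - 1) = 1 - z - z' + 1 := by
      rw [mul_sub, sub_mul, hz]; noncomm_ring
    calc _ = 1 + x₁ * (z - 1) * l₁ + x₁ * (z' - 1) * l₁ +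
          x₁ * (z - 1) * l₁ * (x₁ * (z' - 1) * l₁) := by noncomm_ring
      _ = 1 := by rw [h1, h2]; noncomm_ring
  let D : Cˣ := ⟨1 + x₁ * (y - 1) * l₁, 1 + x₁ * (y' - 1) * l₁, key y y' hyy' hqy,
    key y' y hy'y hqy'⟩
  -- The commutator lies in `N` by normality, although `D` itself need not. Conjugation by the turn
  -- moves `D⁻¹` from the second copy to the first, the two signs cancelling.
  refine ⟨D * w * D⁻¹ * w⁻¹, N.mul_mem (hN.normal.conj_mem w hwN D) (N.inv_mem hwN), ?_⟩
  have h1 : (w : C) * (1 + x₁ * (y' - 1) * l₁) * ((w⁻¹ : Cˣ) : C) = 1 + x₀ * (y' - 1) * l₀ := by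
    rw [mul_add, add_mul, mul_one, Units.mul_inv]
    have : (w : C) * (x₁ * (y' - 1) * l₁) * ((w⁻¹ : Cˣ) : C) =
        ((w : C) * x₁) * (y' - 1) * (l₁ * ((w⁻¹ : Cˣ) : C)) := by simp only [mul_assoc]
    rw [this, hw1, hw1']
    noncomm_ring
  calc ((D * w * D⁻¹ * w⁻¹ : Cˣ) : C)
      = (1 + x₁ * (y - 1) * l₁) * ((w : C) * (1 + x₁ * (y' - 1) * l₁) * ((w⁻¹ : Cˣ) : C)) := by
        have hDv : (D : C) = 1 + x₁ * (y - 1) * l₁ := rfl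
        have hDi : ((D⁻¹ : Cˣ) : C) = 1 + x₁ * (y' - 1) * l₁ := rfl
        rw [Units.val_mul, Units.val_mul, Units.val_mul, hDv, hDi]
        simp only [mul_assoc]
    _ = 1 + x₀ * (y' - 1) * l₀ + x₁ * (y - 1) * l₁ +
          x₁ * (y - 1) * (l₁ * x₀) * ((y' - 1) * l₀) := by
        rw [h1]; noncomm_ring
    _ = _ := by rw [h10]; simp

/-- A unit moving one of two complementary modules into the other one can be disposed of by a
swindle. -/
theorem ContainsElementary.mem_of_swindle (hN : ContainsElementary N) {S S' T T' v v' s s' : C}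
    (hS : S' * S = 1) (hT : T' * T = 1) (hTS : T' * S = 0) (hST : S' * T = 0)
    (hv : v' * v = 1) (hs : s' * s = 1) (hsv : s' * v = 0) (hvs : v' * s = 0)
    (Φ : C →+* C) (hΦ : ∀ a, Φ a = v * a * v' + s * Φ a * s')
    (a : Cˣ) (ha : T' * a * S = 0) : a ∈ N := by
  have aS : ∀ z, S' * (S * z) = z := fun z => by rw [← mul_assoc, hS, one_mul]
  have av : ∀ z, v' * (v * z) = z := fun z => by rw [← mul_assoc, hv, one_mul]
  have as : ∀ z, s' * (s * z) = z := fun z => by rw [← mul_assoc, hs, one_mul]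
  have asv : ∀ z, s' * (v * z) = 0 := fun z => by rw [← mul_assoc, hsv, zero_mul]
  have avs : ∀ z, v' * (s * z) = 0 := fun z => by rw [← mul_assoc, hvs, zero_mul]
  -- Rotate `a * S` to `T`. The factor `1 - T * T'` makes the left inverse of `a * S` vanish on `T`,
  -- and `ha` keeps it a left inverse.
  obtain ⟨w, hwN, hw, -, -, -⟩ := hN.exists_turn (q := 1) (x₀ := a * S)
    (l₀ := S' * ((a⁻¹ : Cˣ) : C) * (1 - T * T')) (x₁ := T) (l₁ := T')
    (by
      calc _ = S' * ((a⁻¹ : Cˣ) : C) * (a * S - T * (T' * a * S)) := by noncomm_ring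
        _ = S' * (((a⁻¹ : Cˣ) : C) * a) * S := by rw [ha, mul_zero, sub_zero]; simp only [mul_assoc]
        _ = 1 := by rw [Units.inv_mul, mul_one, hS])
    (by rw [mul_assoc, sub_mul, mul_assoc T, hT]; simp) (by rw [← mul_assoc, ha]) hT
    (mul_one _) (mul_one _) (one_mul _) (one_mul _)
  -- Rotate `T` back to `S`, so that the composite fixes `S`.
  obtain ⟨r, hrN, hr, -, -, -⟩ := hN.exists_turn (q := 1) (x₀ := T) (l₀ := T') (x₁ := S) (l₁ := S')
    hT hTS hST hS (mul_one _) (mul_one _) (one_mul _) (one_mul _)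
  let b₀ : Cˣ := r * w * a
  have hb₀S : (b₀ : C) * S = S := by
    calc (b₀ : C) * S = r * (w * (a * S)) := by simp only [b₀, Units.val_mul, mul_assoc]
      _ = S := by rw [hw, hr]
  let Q : C := 1 - S * S'
  have hQS : Q * S = 0 := by simp only [Q, sub_mul, mul_assoc, hS]; simp
  have hS'Q : S' * Q = 0 := by simp only [Q, mul_sub, aS]; simp
  have hQQ : Q * Q = Q := by
    calc Q * Q = Q - Q * S * S' := by simp only [Q]; noncomm_ring
      _ = Q := by rw [hQS]; simp
  -- The off-diagonal entry of `b₀` from the complement of `S` into `S`; a unipotent factor removes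
  -- it.
  let n : C := S * (S' * b₀ * Q)
  have hnn : n * n = 0 := by
    calc n * n = S * (S' * b₀) * (Q * S) * (S' * b₀ * Q) := by simp only [n, mul_assoc]
      _ = 0 := by rw [hQS]; simp
  let m : Cˣ := ⟨1 - n, 1 + n, by
    calc (1 - n) * (1 + n) = 1 - n * n := by noncomm_ring
      _ = 1 := by rw [hnn, sub_zero], by
    calc (1 + n) * (1 - n) = 1 - n * n := by noncomm_ring
      _ = 1 := by rw [hnn, sub_zero]⟩
  have hmN : m ∈ N := hN.unipotent_mem m n hnn rfl
  let b : Cˣ := b₀ * m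
  have hb : (b : C) = b₀ - n := by
    calc (b : C) = b₀ * (1 - n) := rfl
      _ = b₀ - (b₀ * S) * (S' * b₀ * Q) := by simp only [n]; noncomm_ring
      _ = b₀ - n := by rw [hb₀S]
  have hbS : (b : C) * S = S := by
    calc (b : C) * S = b₀ * S - S * (S' * b₀ * (Q * S)) := by
          rw [hb]; simp only [n, sub_mul, mul_assoc]
      _ = S := by rw [hQS, hb₀S]; simp
  have hS'b : S' * b = S' := by
    calc S' * b = S' * b₀ - S' * S * (S' * b₀ * Q) := by
          rw [hb]; simp only [n, mul_sub, mul_assoc]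
      _ = S' * (b₀ * S) * S' := by rw [hS]; simp only [Q]; noncomm_ring
      _ = S' := by rw [hb₀S, hS, one_mul]
  have hbS' : ((b⁻¹ : Cˣ) : C) * S = S := by
    rw [Units.inv_mul_eq_iff_eq_mul, hbS]
  have hS'b' : S' * ((b⁻¹ : Cˣ) : C) = S' := by
    rw [Units.mul_inv_eq_iff_eq_mul, hS'b]
  have hQcomm : ∀ y : C, y * S = S → S' * y = S' → Q * y = y * Q ∧ Q * (y - 1) * Q = y - 1 := by
    intro y h1 h2
    have h3 : Q * y = y - S * S' := by simp only [Q, sub_mul, mul_assoc, h2, one_mul]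
    have h4 : y * Q = y - S * S' := by simp only [Q, mul_sub, ← mul_assoc, h1, mul_one]
    refine ⟨h3.trans h4.symm, ?_⟩
    calc Q * (y - 1) * Q = (Q * y) * Q - Q * Q := by noncomm_ring
      _ = y * Q * Q - Q * Q := by rw [h3, ← h4]
      _ = y * Q - Q := by rw [mul_assoc, hQQ]
      _ = y - 1 := by rw [h4]; simp only [Q]; abel
  obtain ⟨hQb, hQbQ⟩ := hQcomm b hbS hS'b
  obtain ⟨hQb', hQbQ'⟩ := hQcomm _ hbS' hS'b'
  have hΦb : Φ b * Φ ((b⁻¹ : Cˣ) : C) = 1 := by rw [← map_mul, Units.mul_inv, map_one]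
  have hΦb' : Φ ((b⁻¹ : Cˣ) : C) * Φ b = 1 := by rw [← map_mul, Units.inv_mul, map_one]
  -- Now `b` is `1` on `S` and lives on `Q`. The element `w₁` is `b` on `Q` and `b⁻¹` on a copy
  -- inside `S * v * v`. Both `w₂` and `w₃` are `Φ b` on `S * s`, while `Φ b⁻¹` sits on `S * v * s`
  -- in `w₂` and on `S * v` in `w₃`. As `Φ` absorbs one more copy, `w₁ * w₂ = b * w₃`.
  obtain ⟨w₁, hw₁N, hw₁⟩ := hN.exists_whitehead (q := Q) (x₀ := S * v * v * Q)
    (l₀ := Q * v' * v' * S') (x₁ := Q) (l₁ := Q)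
    (by simp only [mul_assoc, aS, av, hQQ]) (by simp only [mul_assoc, hS'Q, mul_zero])
    (by simp only [← mul_assoc, hQS, zero_mul]) hQQ (by simp only [mul_assoc, hQQ]) hQQ
    (by simp only [← mul_assoc, hQQ]) hQQ (Units.mul_inv b) (Units.inv_mul b) hQb hQb'
  obtain ⟨w₂, hw₂N, hw₂⟩ := hN.exists_whitehead (q := 1) (x₀ := S * v * s)
    (l₀ := s' * v' * S') (x₁ := S * s) (l₁ := s' * S')
    (by simp only [mul_assoc, aS, av, hs]) (by simp only [mul_assoc, aS, hvs, mul_zero])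
    (by simp only [mul_assoc, aS, asv]) (by simp only [mul_assoc, aS, hs])
    (mul_one _) (mul_one _) (one_mul _) (one_mul _) hΦb hΦb' (by simp) (by simp)
  obtain ⟨w₃, hw₃N, hw₃⟩ := hN.exists_whitehead (q := 1) (x₀ := S * v)
    (l₀ := v' * S') (x₁ := S * s) (l₁ := s' * S')
    (by simp only [mul_assoc, aS, hv]) (by simp only [mul_assoc, aS, hvs])
    (by simp only [mul_assoc, aS, hsv]) (by simp only [mul_assoc, aS, hs])
    (mul_one _) (mul_one _) (one_mul _) (one_mul _) hΦb hΦb' (by simp) (by simp)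
  have hprod : w₁ * w₂ = b * w₃ := by
    apply Units.ext
    have e1 : (w₁ : C) = b + S * (v * (v * ((((b⁻¹ : Cˣ) : C) - 1) * (v' * (v' * S'))))) := by
      have h1 : S * v * v * Q * (((b⁻¹ : Cˣ) : C) - 1) * (Q * v' * v' * S') =
          S * v * v * (Q * (((b⁻¹ : Cˣ) : C) - 1) * Q) * v' * v' * S' := by simp only [mul_assoc]
      rw [hw₁, h1, hQbQ, hQbQ']
      simp only [mul_assoc]
      abel
    have hΦ1 : Φ ((b⁻¹ : Cˣ) : C) - 1 = v * ((((b⁻¹ : Cˣ) : C) - 1) * v') +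
        s * ((Φ ((b⁻¹ : Cˣ) : C) - 1) * s') := by
      have := hΦ (((b⁻¹ : Cˣ) : C) - 1)
      rw [map_sub, map_one] at this
      simpa only [mul_assoc] using this
    have e2 : (w₂ : C) = 1 + S * (v * (s * ((Φ ((b⁻¹ : Cˣ) : C) - 1) * (s' * (v' * S'))))) +
        S * (s * ((Φ b - 1) * (s' * S'))) := by
      rw [hw₂]; simp only [mul_assoc]
    have e3 : (w₃ : C) = 1 + S * (v * ((v * ((((b⁻¹ : Cˣ) : C) - 1) * v') +
        s * ((Φ ((b⁻¹ : Cˣ) : C) - 1) * s')) * (v' * S'))) +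
        S * (s * ((Φ b - 1) * (s' * S'))) := by
      rw [hw₃, ← hΦ1]; simp only [mul_assoc]
    have abS : ∀ z, (b : C) * (S * z) = S * z := fun z => by rw [← mul_assoc, hbS]
    rw [Units.val_mul, Units.val_mul, e1, e2, e3]
    generalize Φ ((b⁻¹ : Cˣ) : C) - 1 = α
    generalize Φ (b : C) - 1 = β
    generalize ((b⁻¹ : Cˣ) : C) - 1 = γ
    simp only [mul_add, add_mul, mul_one, mul_assoc, aS, av, avs, abS, mul_zero, add_zero]
    abel
  have hbN : b ∈ N := by
    have : b = w₁ * w₂ * w₃⁻¹ := by rw [hprod, mul_inv_cancel_right]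
    rw [this]
    exact N.mul_mem (N.mul_mem hw₁N hw₂N) (N.inv_mem hw₃N)
  have : a = (r * w)⁻¹ * b * m⁻¹ := by simp only [b, b₀]; group
  rw [this]
  exact N.mul_mem (N.mul_mem (N.inv_mem (N.mul_mem hrN hwN)) hbN) (N.inv_mem hmN)

end AbstractSwindle

/-! ### Deformable units contain the elementary ones. -/

section Deformation

variable {B C : Type*} [Ring B] [Ring C]

/-- The units of `C` that can be deformed to `1`, where the ring `B` consists of the deformations of
elements of `C`, and `e₀` and `e₁` give the two ends of a deformation. -/
def deformable (e₀ e₁ : B →+* C) : Subgroup Cˣ :=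
  (Units.map (e₁ : B →* C)).ker.map (Units.map (e₀ : B →* C))

theorem mem_deformable {e₀ e₁ : B →+* C} {w : Cˣ} :
    w ∈ deformable e₀ e₁ ↔ ∃ f : Bˣ, e₀ f = w ∧ e₁ f = 1 := by
  simp only [deformable, Subgroup.mem_map, MonoidHom.mem_ker, Units.ext_iff]
  exact ⟨fun ⟨f, h, h'⟩ => ⟨f, h', h⟩, fun ⟨f, h, h'⟩ => ⟨f, h', h⟩⟩

/-- Constant deformations lift every unit of `C`, which gives normality. On the image of `P` the
element `K` is a square root of `-1`, so `1 + (γ - 1) * P + σ * K` is a rotation, with inverse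
obtained from `-σ`. The unipotents contract along `1 - τ * n`. -/
theorem containsElementary_deformable {e₀ e₁ : B →+* C} (k : C →+* B) (hk₀ : ∀ x, e₀ (k x) = x)
    {τ γ σ : B} (hτ : ∀ x, τ * x = x * τ) (hγ : ∀ x, γ * x = x * γ)
    (hσ : ∀ x, σ * x = x * σ) (hγσ : γ * γ + σ * σ = 1) (hτ₀ : e₀ τ = 1) (hτ₁ : e₁ τ = 0)
    (hγ₀ : e₀ γ = 0) (hγ₁ : e₁ γ = 1) (hσ₀ : e₀ σ = 1) (hσ₁ : e₁ σ = 0) :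
    ContainsElementary (deformable e₀ e₁) where
  normal := by
    refine Subgroup.Normal.map inferInstance _ fun w => ⟨Units.map (k : C →* B) w, ?_⟩
    exact Units.ext (hk₀ w)
  quarterTurn_mem {P K} hP hPK hKP hK := by
    have key : ∀ ε : B, (∀ x, ε * x = x * ε) → ε * ε = σ * σ →
        (1 + (γ - 1) * k P + ε * k K) * (1 + (γ - 1) * k P - ε * k K) = 1 := by
      intro ε hε hεσ
      have h1 : (γ - 1) * k P * ((γ - 1) * k P) = (γ - 1) * (γ - 1) * k P := by
        rw [mul_assoc, ← mul_assoc (k P), show k P * (γ - 1) = (γ - 1) * k P by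
          rw [mul_sub, sub_mul, hγ, mul_one, one_mul], mul_assoc (γ - 1) (k P), ← map_mul, hP,
          mul_assoc]
      have h2 : (γ - 1) * k P * (ε * k K) = (γ - 1) * ε * k K := by
        rw [mul_assoc, ← mul_assoc (k P), ← hε (k P), mul_assoc ε, ← map_mul, hPK, mul_assoc]
      have h3 : ε * k K * ((γ - 1) * k P) = (γ - 1) * ε * k K := by
        rw [mul_assoc, ← mul_assoc (k K), show k K * (γ - 1) = (γ - 1) * k K by
          rw [mul_sub, sub_mul, hγ, mul_one, one_mul], mul_assoc (γ - 1) (k K), ← map_mul, hKP,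
          ← mul_assoc, hε]
      have h4 : ε * k K * (ε * k K) = -(ε * ε * k P) := by
        rw [mul_assoc, ← mul_assoc (k K), ← hε (k K), mul_assoc ε (k K), ← map_mul, hK, map_neg]
        noncomm_ring
      calc _ = 1 + 2 * ((γ - 1) * k P) + (γ - 1) * k P * ((γ - 1) * k P) -
            (γ - 1) * k P * (ε * k K) + ε * k K * ((γ - 1) * k P) - ε * k K * (ε * k K) := by
              noncomm_ring
        _ = 1 + (γ * γ + ε * ε - 1) * k P := by rw [h1, h2, h3, h4]; noncomm_ring
        _ = 1 := by rw [hεσ, hγσ]; simp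
    have hneg : ∀ x, -σ * x = x * -σ := fun x => by rw [neg_mul, mul_neg, hσ]
    refine mem_deformable.2 ⟨⟨1 + (γ - 1) * k P + σ * k K, 1 + (γ - 1) * k P - σ * k K,
      key σ hσ rfl, ?_⟩, ?_, ?_⟩
    · simpa [sub_eq_add_neg] using key (-σ) hneg (by simp)
    · simp only [map_add, map_sub, map_mul, map_one, hγ₀, hσ₀, hk₀]
      change _ = 1 - P + K
      noncomm_ring
    · simp [hγ₁, hσ₁]
  unipotent_mem w n hn hw := by
    have h : τ * k n * (τ * k n) = 0 := by
      rw [mul_assoc, ← mul_assoc (k n), ← hτ (k n), mul_assoc τ, ← map_mul, hn]; simp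
    refine mem_deformable.2 ⟨⟨1 - τ * k n, 1 + τ * k n, ?_, ?_⟩, ?_, ?_⟩
    · calc _ = 1 - τ * k n * (τ * k n) := by noncomm_ring
        _ = 1 := by rw [h, sub_zero]
    · calc _ = 1 - τ * k n * (τ * k n) := by noncomm_ring
        _ = 1 := by rw [h, sub_zero]
    · simp [hτ₀, hk₀, hw]
    · simp [hτ₁]

end Deformation

/-! ### Rings of equivariant operator-valued functions. -/

section EquivariantMaps

variable {G X A : Type*} [TopologicalSpace X] [NormedRing A] [StarRing A]
  [NormedAlgebra ℂ A]

/-- The ring of continuous equivariant maps from a space to a normed algebra. -/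
def equivariantMaps (α : G → X → X) (ρ : G → A ≃⋆ₐ[ℂ] A) : Subring C(X, A) where
  carrier := {f | ∀ g x, f (α g x) = ρ g (f x)}
  mul_mem' {f h} hf hh g x := by simp [hf g x, hh g x]
  one_mem' g x := by simp
  add_mem' {f h} hf hh g x := by simp [hf g x, hh g x]
  zero_mem' g x := by simp
  neg_mem' {f} hf g x := by simp [hf g x]

variable {α : G → X → X} {ρ : G → A ≃⋆ₐ[ℂ] A}

/-- A continuous equivariant map with invertible values is invertible. -/
theorem equivariantMaps.isUnit [CompleteSpace A] (f : equivariantMaps α ρ)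
    (hf : ∀ x, IsUnit (f.1 x)) : IsUnit f := by
  have hinv : Continuous fun x => Ring.inverse (f.1 x) := by
    rw [continuous_iff_continuousAt]
    intro x
    obtain ⟨u, hu⟩ := hf x
    exact (hu ▸ NormedRing.inverse_continuousAt u : ContinuousAt Ring.inverse (f.1 x)).comp
      f.1.continuous.continuousAt
  refine ⟨⟨f, ⟨⟨_, hinv⟩, fun g x => ?_⟩, ?_, ?_⟩, rfl⟩
  · change Ring.inverse (f.1 (α g x)) = ρ g (Ring.inverse (f.1 x))
    rw [f.2 g x]
    obtain ⟨u, hu⟩ := hf x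
    rw [← hu, Ring.inverse_unit, show ρ g (u : A) = Units.map (ρ g : A →* A) u from rfl,
      Ring.inverse_unit]
    rfl
  · exact Subtype.ext (ContinuousMap.ext fun x => Ring.mul_inverse_cancel _ (hf x))
  · exact Subtype.ext (ContinuousMap.ext fun x => Ring.inverse_mul_cancel _ (hf x))

/-- The trivial extension of an action to the product with the unit interval. -/
def cylinderAction (α : G → X → X) (g : G) (p : unitInterval × X) : unitInterval × X :=
  (p.1, α g p.2)

variable (α ρ)

/-- The value of a deformation at a given time. -/
def equivariantMaps.eval (t : unitInterval) :
    equivariantMaps (cylinderAction α) ρ →+* equivariantMaps α ρ where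
  toFun f := ⟨⟨fun x => f.1 (t, x), f.1.continuous.comp (by fun_prop)⟩, fun g x => f.2 g (t, x)⟩
  map_one' := rfl
  map_mul' _ _ := rfl
  map_zero' := rfl
  map_add' _ _ := rfl

/-- The constant deformation. -/
def equivariantMaps.const :
    equivariantMaps α ρ →+* equivariantMaps (cylinderAction α) ρ where
  toFun f := ⟨⟨fun p => f.1 p.2, f.1.continuous.comp continuous_snd⟩, fun g p => f.2 g p.2⟩
  map_one' := rfl
  map_mul' _ _ := rfl
  map_zero' := rfl
  map_add' _ _ := rfl

/-- A scalar function of time. -/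
noncomputable def equivariantMaps.scalar (h : C(unitInterval, ℂ)) : equivariantMaps (cylinderAction α) ρ :=
  ⟨⟨fun p => algebraMap ℂ A (h p.1), by fun_prop⟩, fun g p => by
    change algebraMap ℂ A (h p.1) = ρ g (algebraMap ℂ A (h p.1))
    rw [AlgHomClass.commutes]⟩

theorem equivariantMaps.scalar_mul (h : C(unitInterval, ℂ))
    (f : equivariantMaps (cylinderAction α) ρ) : scalar α ρ h * f = f * scalar α ρ h :=
  Subtype.ext (ContinuousMap.ext fun _ => Algebra.commutes _ _)

/-- The function of time that decreases linearly from `1` to `0`. -/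
noncomputable def decreasingTime : C(unitInterval, ℂ) := ⟨fun t => ((1 - t : ℝ) : ℂ), by fun_prop⟩

theorem equivariantMaps.containsElementary :
    ContainsElementary (deformable (eval α ρ 0) (eval α ρ 1)) := by
  -- The angle runs so that time `0` is the quarter turn and time `1` is the identity.
  let c : C(unitInterval, ℂ) := ⟨fun t => Complex.sin (Real.pi / 2 * t), by fun_prop⟩
  let s : C(unitInterval, ℂ) := ⟨fun t => Complex.cos (Real.pi / 2 * t), by fun_prop⟩
  have hval : ∀ (h : C(unitInterval, ℂ)) (t : unitInterval) (z : ℂ), h t = z → ∀ x,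
      (eval α ρ t (scalar α ρ h)).1 x = algebraMap ℂ A z := by
    rintro h t z rfl x; rfl
  have h0 : ∀ (h : C(unitInterval, ℂ)) (t : unitInterval), h t = 0 →
      eval α ρ t (scalar α ρ h) = 0 := fun h t ht =>
    Subtype.ext (ContinuousMap.ext fun x => (hval h t 0 ht x).trans (map_zero _))
  have h1 : ∀ (h : C(unitInterval, ℂ)) (t : unitInterval), h t = 1 →
      eval α ρ t (scalar α ρ h) = 1 := fun h t ht =>
    Subtype.ext (ContinuousMap.ext fun x => (hval h t 1 ht x).trans (map_one _))
  refine containsElementary_deformable (const α ρ) (fun _ => rfl)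
    (scalar_mul α ρ decreasingTime) (scalar_mul α ρ c) (scalar_mul α ρ s) ?_
    (h1 _ _ ?_) (h0 _ _ ?_) (h0 _ _ ?_) (h1 _ _ ?_) (h1 _ _ ?_) (h0 _ _ ?_)
  · refine Subtype.ext (ContinuousMap.ext fun p => ?_)
    change algebraMap ℂ A (Complex.sin _) * algebraMap ℂ A (Complex.sin _) +
      algebraMap ℂ A (Complex.cos _) * algebraMap ℂ A (Complex.cos _) = 1
    rw [← map_mul, ← map_mul, ← map_add, ← sq, ← sq, Complex.sin_sq_add_cos_sq, map_one]
  · simp [decreasingTime]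
  · simp [decreasingTime]
  · simp [c]
  · simp [c]
  · simp [s]
  · simp [s]

variable {α ρ}

/-- A unitary equivariant map is deformable if it moves one module almost into another one that is
orthogonal to it. -/
theorem equivariantMaps.mem_deformable_of_almost_orthogonal [CompleteSpace A]
    {S S' T T' v v' s s' : equivariantMaps α ρ}
    (hS : S' * S = 1) (hT : T' * T = 1) (hTS : T' * S = 0) (hST : S' * T = 0)
    (hv : v' * v = 1) (hs : s' * s = 1) (hsv : s' * v = 0) (hvs : v' * s = 0)
    (Φ : equivariantMaps α ρ →+* equivariantMaps α ρ)
    (hΦ : ∀ a, Φ a = v * a * v' + s * Φ a * s') (u : (equivariantMaps α ρ)ˣ)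
    (hu : ∀ x, ‖(((u⁻¹ : (equivariantMaps α ρ)ˣ) : equivariantMaps α ρ) *
      (T * (T' * u * S) * S')).1 x‖ < 1) :
    u ∈ deformable (eval α ρ 0) (eval α ρ 1) := by
  have hN := containsElementary α ρ
  -- The part of `u` that leads from `S` to `T`. Since `u - d = u * (1 - w)` with `w` of norm below
  -- `1` at each point, subtracting `d` changes `u` only by a deformable unit.
  let d : equivariantMaps α ρ := T * (T' * u * S) * S'
  let w : equivariantMaps α ρ := ((u⁻¹ : (equivariantMaps α ρ)ˣ) : equivariantMaps α ρ) * d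
  have hunit : IsUnit (1 - scalar α ρ decreasingTime * const α ρ w) := by
    refine isUnit _ fun p => ?_
    change IsUnit (1 - algebraMap ℂ A (((1 - (p.1 : ℝ) : ℝ) : ℂ)) * w.1 p.2)
    refine isUnit_one_sub_of_norm_lt_one ?_
    rw [← Algebra.smul_def, norm_smul, Complex.norm_real, Real.norm_of_nonneg
      (by linarith [p.1.2.2])]
    have := hu p.2
    have h1 : (1 - (p.1 : ℝ)) ≤ 1 := by linarith [p.1.2.1]
    exact (mul_le_of_le_one_left (norm_nonneg _) h1).trans_lt this
  obtain ⟨f, hf⟩ := hunit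
  have hf₁ : eval α ρ 1 f = 1 := by
    rw [hf]
    refine Subtype.ext (ContinuousMap.ext fun x => ?_)
    change 1 - algebraMap ℂ A (((1 - ((1 : unitInterval) : ℝ) : ℝ) : ℂ)) * w.1 x = 1
    simp
  have hf₀ : eval α ρ 0 f = 1 - w := by
    rw [hf]
    refine Subtype.ext (ContinuousMap.ext fun x => ?_)
    change 1 - algebraMap ℂ A (((1 - ((0 : unitInterval) : ℝ) : ℝ) : ℂ)) * w.1 x = 1 - w.1 x
    simp
  let b : (equivariantMaps α ρ)ˣ := Units.map (eval α ρ 0 : _ →* equivariantMaps α ρ) f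
  have hb : b ∈ deformable (eval α ρ 0) (eval α ρ 1) := mem_deformable.2 ⟨f, rfl, hf₁⟩
  have ha : u * b ∈ deformable (eval α ρ 0) (eval α ρ 1) := by
    refine hN.mem_of_swindle hS hT hTS hST hv hs hsv hvs Φ hΦ (u * b) ?_
    have h1 : ((u * b : (equivariantMaps α ρ)ˣ) : equivariantMaps α ρ) = u - d := by
      rw [Units.val_mul, show (b : equivariantMaps α ρ) = 1 - w from hf₀, mul_sub, mul_one,
        Units.mul_inv_cancel_left]
    calc T' * ((u * b : (equivariantMaps α ρ)ˣ) : equivariantMaps α ρ) * S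
        = T' * u * S - (T' * T) * (T' * u * S) * (S' * S) := by
          rw [h1, mul_sub, sub_mul]; simp only [d, mul_assoc]
      _ = 0 := by rw [hT, hS]; simp
  exact (Subgroup.mul_mem_cancel_right _ hb).1 ha

end EquivariantMaps

/-! ### The unitary factor of an invertible element. -/

section Polar

open Topology

variable {A : Type*} [CStarAlgebra A]

theorem IsUnit.spectrum_star_mul_self_pos {a : A} (ha : IsUnit a) {t : ℝ}
    (ht : t ∈ spectrum ℝ (star a * a)) : 0 < t := by
  refine lt_of_le_of_ne (spectrum_star_mul_self_nonneg t ht) ?_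
  rintro rfl
  exact spectrum.zero_notMem ℝ (ha.star.mul ha) ht

/-- The unitary factor in the polar decomposition of an invertible element. -/
noncomputable def polarPart (a : A) : A := a * cfc (fun t : ℝ => (√t)⁻¹) (star a * a)

theorem IsUnit.continuousOn_inv_sqrt {a : A} (ha : IsUnit a) :
    ContinuousOn (fun t : ℝ => (√t)⁻¹) (spectrum ℝ (star a * a)) :=
  Real.continuous_sqrt.continuousOn.inv₀ fun _ ht =>
    (Real.sqrt_pos.2 (ha.spectrum_star_mul_self_pos ht)).ne'

/-- With `q` the inverse square root of `star a * a`, the identity `q * (star a * a) * q = 1` makes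
`a * q` an isometry; it is also invertible, hence unitary. -/
theorem polarPart_mem_unitary {a : A} (ha : IsUnit a) : polarPart a ∈ unitary A := by
  have hf := ha.continuousOn_inv_sqrt
  set q : A := cfc (fun t : ℝ => (√t)⁻¹) (star a * a) with hq
  have hqs : star q = q := (cfc_predicate _ _ : IsSelfAdjoint q)
  have h1 : q * (star a * a) * q = 1 := by
    rw [hq]
    nth_rewrite 2 [← cfc_id ℝ (star a * a)]
    rw [← cfc_mul _ _ _ hf continuousOn_id,
      ← cfc_mul (fun t : ℝ => (√t)⁻¹ * id t) _ _ (hf.mul continuousOn_id) hf,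
      ← cfc_one ℝ (star a * a)]
    refine cfc_congr fun t ht => ?_
    have ht0 := ha.spectrum_star_mul_self_pos ht
    have hs := (Real.sqrt_pos.2 ht0).ne'
    simp only [id, Pi.one_apply]
    nth_rewrite 2 [← Real.mul_self_sqrt ht0.le]
    field_simp
  have hqu : IsUnit q := by
    refine isUnit_iff_exists_and_exists.2 ⟨⟨star a * a * q, ?_⟩, ⟨q * (star a * a), h1⟩⟩
    rw [← mul_assoc, h1]
  have h2 : star (polarPart a) * polarPart a = 1 := by
    rw [polarPart, ← hq, star_mul, hqs, ← h1]
    simp only [mul_assoc]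
  obtain ⟨u, hu⟩ := ha.mul hqu
  refine ⟨h2, ?_⟩
  have hu' : (u : A) = polarPart a := hu
  rw [← hu'] at h2 ⊢
  have h3 : star (u : A) = ((u⁻¹ : Aˣ) : A) := Units.eq_inv_of_mul_eq_one_right h2
  rw [h3, Units.mul_inv]

theorem polarPart_of_mem_unitary {a : A} (ha : a ∈ unitary A) : polarPart a = a := by
  rw [polarPart, Unitary.star_mul_self_of_mem ha, cfc_apply_one]
  simp

theorem polarPart_map (φ : A ≃⋆ₐ[ℂ] A) {a : A} (ha : IsUnit a) :
    polarPart (φ a) = φ (polarPart a) := by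
  have hφ : Continuous φ := (StarAlgEquiv.isometry φ).continuous
  rw [polarPart, polarPart, map_mul, StarAlgHomClass.map_cfc φ _ _ ha.continuousOn_inv_sqrt hφ
    (IsSelfAdjoint.star_mul_self a) (by rw [map_mul, map_star]; exact IsSelfAdjoint.star_mul_self (φ a)), map_mul, map_star]

theorem Continuous.polarPart {X : Type*} [TopologicalSpace X] {f : X → A} (hf : Continuous f)
    (hu : ∀ x, IsUnit (f x)) : Continuous fun x => polarPart (f x) := by
  refine hf.mul (Continuous.cfc_of_mem_nhdsSet (s := Set.Ioi 0) _ ?_ (by fun_prop)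
    (fun x => IsSelfAdjoint.star_mul_self (f x)) ?_)
  · refine isOpen_Ioi.mem_nhdsSet.2 ?_
    exact Set.iUnion_subset fun x t ht => (hu x).spectrum_star_mul_self_pos ht
  · exact Real.continuous_sqrt.continuousOn.inv₀ fun t ht => (Real.sqrt_pos.2 ht).ne'

end Polar

theorem norm_mul_lt_one {R : Type*} [NormedRing R] {a b c d : R} (ha : ‖a‖ ≤ 1) (hb : ‖b‖ ≤ 1)
    (hc : ‖c‖ ≤ 1 / 2) (hd : ‖d‖ ≤ 1) : ‖a * (b * c * d)‖ < 1 := by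
  calc _ ≤ ‖a‖ * (‖b‖ * ‖c‖ * ‖d‖) := by
        refine (norm_mul_le _ _).trans ?_
        gcongr
        refine (norm_mul_le _ _).trans ?_
        gcongr
        exact norm_mul_le _ _
    _ ≤ 1 * (1 * (1 / 2) * 1) := by gcongr
    _ < 1 := by norm_num

/-! ### Deformation of the tautological function and conclusion. -/

namespace GHilbertStructure

variable {G : Type*} [Group G] [TopologicalSpace G]
  {H : Type*} [NormedAddCommGroup H] [InnerProductSpace ℂ H] [CompleteSpace H]
  {π : GHilbertStructure G H}

theorem conjStarAlgAut_hom (g : G) (a : H →L[ℂ] H) :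
    Unitary.conjStarAlgAut ℂ (H →L[ℂ] H) (π.hom g) a = π.op g * a * π.op g⁻¹ := by
  rw [← star_op]
  rfl

variable [IsTopologicalGroup G]

/-- The ring of continuous equivariant operator-valued functions on the space of `G`-continuous
unitary operators. -/
noncomputable abbrev operatorFunctions (π : GHilbertStructure G H) :
    Subring C(π.unitaryGCts, H →L[ℂ] H) :=
  equivariantMaps (fun (g : G) (x : π.unitaryGCts) => g • x)
    fun g => Unitary.conjStarAlgAut ℂ (H →L[ℂ] H) (π.hom g)

/-- Invariant families of intertwiners are equivariant. -/
noncomputable def operatorFunctions.ofInvariant (R : π.unitaryGCts → H →L[ℂ] H) (hR : Continuous R)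
    (hinv : ∀ (g : G) x, R (g • x) = R x) (hop : ∀ x g, R x * π.op g = π.op g * R x) :
    π.operatorFunctions :=
  ⟨⟨R, hR⟩, fun g x => by
    change R (g • x) = _
    rw [conjStarAlgAut_hom, hinv]
    change _ = π.op g * R x * π.op g⁻¹
    rw [← hop, mul_assoc, op_mul_op_inv, mul_one]⟩

/-- The tautological function as a unit. -/
noncomputable def operatorFunctions.tautological (π : GHilbertStructure G H) : (π.operatorFunctions)ˣ where
  val := ⟨⟨toOp, continuous_toOp⟩, fun g x => (toOp_smul g x).trans (conjStarAlgAut_hom _ _).symm⟩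
  inv := ⟨⟨fun x => star (toOp x), continuous_toOp.star⟩, fun g x => by
    change star (toOp (g • x)) = _
    rw [conjStarAlgAut_hom, toOp_smul, star_mul, star_mul, star_op, star_op, inv_inv, mul_assoc]
    rfl⟩
  val_inv := Subtype.ext (ContinuousMap.ext fun x => Unitary.coe_mul_star_self x.1)
  inv_val := Subtype.ext (ContinuousMap.ext fun x => Unitary.coe_star_mul_self x.1)

/-- The swindle applied to operator-valued functions. -/
noncomputable def SwindleData.mapOperatorFunctions (W : π.SwindleData) :
    π.operatorFunctions →+* π.operatorFunctions where
  toFun f := ⟨⟨fun x => W.Φ (f.1 x), W.continuous_Φ.comp f.1.continuous⟩, fun g x => by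
    change W.Φ (f.1 (g • x)) = _
    rw [f.2 g x, conjStarAlgAut_hom, W.Φ_conj, ← conjStarAlgAut_hom]
    rfl⟩
  map_one' := Subtype.ext (ContinuousMap.ext fun _ => map_one W.Φ)
  map_mul' f h := Subtype.ext (ContinuousMap.ext fun x => map_mul W.Φ (f.1 x) (h.1 x))
  map_zero' := Subtype.ext (ContinuousMap.ext fun _ => map_zero W.Φ)
  map_add' f h := Subtype.ext (ContinuousMap.ext fun x => map_add W.Φ (f.1 x) (h.1 x))

-- The sections `S`, `T` and the swindle isometries are invariant families of intertwiners, as are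
-- their adjoints, so they all belong to the ring of equivariant functions and the algebraic swindle
-- applies there.
open operatorFunctions in
theorem tautological_mem_deformable [CompactSpace G] (hπ : π.IsStable) :
    tautological π ∈ deformable
      (equivariantMaps.eval (fun (g : G) (x : π.unitaryGCts) => g • x)
        (fun g => Unitary.conjStarAlgAut ℂ (H →L[ℂ] H) (π.hom g)) 0)
      (equivariantMaps.eval (fun (g : G) (x : π.unitaryGCts) => g • x)
        (fun g => Unitary.conjStarAlgAut ℂ (H →L[ℂ] H) (π.hom g)) 1) := by
  obtain ⟨D⟩ := IsStable.exists_decomposition π hπ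
  obtain ⟨W, hW⟩ := D.exists_swindleData
  refine (exists_almost_orthogonal_sections D W hW).elim fun S h => h.elim fun T h => ?_
  have ⟨hSc, hTc, hSi, hTi, hSop, hTop, hS, hT, hTS, hnorm⟩ := h
  have hfun : ∀ {f h : π.operatorFunctions}, (∀ x, f.1 x = h.1 x) → f = h :=
    fun h => Subtype.ext (ContinuousMap.ext h)
  have hsv : star W.v * W.s = 0 := by
    have := congrArg star W.star_s_mul_v
    simpa using this
  have hST : ∀ x, star (S x) * T x = 0 := fun x => by
    have := congrArg star (hTS x)
    simpa using this
  let S₁ := ofInvariant S hSc hSi hSop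
  let S₂ := ofInvariant (fun x => star (S x)) hSc.star (fun g x => by rw [hSi])
    fun x => star_mul_op (hSop x)
  let T₁ := ofInvariant T hTc hTi hTop
  let T₂ := ofInvariant (fun x => star (T x)) hTc.star (fun g x => by rw [hTi])
    fun x => star_mul_op (hTop x)
  let v₁ : π.operatorFunctions :=
    ofInvariant (fun _ => W.v) continuous_const (fun _ _ => rfl) fun _ => W.v_op
  let v₂ : π.operatorFunctions :=
    ofInvariant (fun _ => star W.v) continuous_const (fun _ _ => rfl) fun _ => star_mul_op W.v_op
  let s₁ : π.operatorFunctions :=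
    ofInvariant (fun _ => W.s) continuous_const (fun _ _ => rfl) fun _ => W.s_op
  let s₂ : π.operatorFunctions :=
    ofInvariant (fun _ => star W.s) continuous_const (fun _ _ => rfl) fun _ => star_mul_op W.s_op
  have e1 : S₂ * S₁ = 1 := hfun hS
  have e2 : T₂ * T₁ = 1 := hfun hT
  have e3 : T₂ * S₁ = 0 := hfun hTS
  have e4 : S₂ * T₁ = 0 := hfun hST
  have e5 : v₂ * v₁ = 1 := hfun fun _ => W.star_v_mul_v
  have e6 : s₂ * s₁ = 1 := hfun fun _ => W.star_s_mul_s
  have e7 : s₂ * v₁ = 0 := hfun fun _ => W.star_s_mul_v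
  have e8 : v₂ * s₁ = 0 := hfun fun _ => hsv
  have e9 : ∀ f, W.mapOperatorFunctions f = v₁ * f * v₂ + s₁ * W.mapOperatorFunctions f * s₂ :=
    fun f => hfun fun x => W.Φ_eq (f.1 x)
  refine equivariantMaps.mem_deformable_of_almost_orthogonal e1 e2 e3 e4 e5 e6 e7 e8
    W.mapOperatorFunctions e9 (tautological π) fun x => ?_
  · change ‖star (toOp x) * (T x * (star (T x) * toOp x * S x) * star (S x))‖ < 1
    have hx : ‖star (toOp x)‖ ≤ 1 := by
      rw [norm_star]
      exact norm_le_one_of_star_mul_self (Unitary.coe_star_mul_self x.1)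
    have hSn : ‖star (S x)‖ ≤ 1 := by
      rw [norm_star]
      exact norm_le_one_of_star_mul_self (hS x)
    exact norm_mul_lt_one hx (norm_le_one_of_star_mul_self (hT x)) (hnorm x) hSn

end GHilbertStructure

open GHilbertStructure in
theorem propositionA3p1 {G : Type*} [Group G] [TopologicalSpace G] [IsTopologicalGroup G]
    [CompactSpace G] [T2Space G]
    {H : Type*} [NormedAddCommGroup H] [InnerProductSpace ℂ H] [CompleteSpace H]
    (π : GHilbertStructure G H) (hπ : π.IsStable) :
    EquivariantlyContractible G π.unitaryGCts := by
  obtain ⟨f, hf₀, hf₁⟩ := mem_deformable.1 (tautological_mem_deformable hπ)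
  have hunit : ∀ p, IsUnit (f.1.1 p) := fun p =>
    ⟨⟨f.1.1 p, (f⁻¹).1.1 p, congrArg (fun h => h.1 p) f.mul_inv,
      congrArg (fun h => h.1 p) f.inv_mul⟩, rfl⟩
  have hequiv : ∀ (g : G) (t : unitInterval) (x : π.unitaryGCts),
      polarPart (f.1.1 (t, g • x)) =
        (π.hom g * ⟨_, polarPart_mem_unitary (hunit (t, x))⟩ * (π.hom g)⁻¹ :
          unitary (H →L[ℂ] H)) := by
    intro g t x
    have h := f.1.2 g (t, x)
    change f.1.1 (t, g • x) = _ at h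
    rw [h, polarPart_map _ (hunit (t, x))]
    rfl
  have hcont : Continuous fun p => polarPart (f.1.1 p) := f.1.1.continuous.polarPart hunit
  -- The values are `G`-continuous because conjugating `F (t, x)` by `g` gives `F (t, g • x)`, which
  -- is norm continuous in `g`.
  let F : unitInterval × π.unitaryGCts → π.unitaryGCts := fun p =>
    ⟨⟨_, polarPart_mem_unitary (hunit p)⟩, by
      rw [mem_unitaryGCts]
      refine continuous_induced_rng.2 ?_
      have h : Continuous fun g : G => polarPart (f.1.1 (p.1, g • p.2)) :=
        hcont.comp (by fun_prop)
      exact h.congr fun g => hequiv g p.1 p.2⟩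
  refine ⟨1, fun g => Subtype.ext ?_, ⟨⟨F, ?_⟩, fun x => ?_, fun x => ?_⟩, fun g t x => ?_⟩
  · rw [coe_smul_unitaryGCts]
    simp
  · exact (hcont.subtype_mk _).subtype_mk _
  · refine Subtype.ext (Subtype.ext ?_)
    have h : f.1.1 (0, x) = toOp x := congrArg (fun h => h.1 x) hf₀
    change polarPart (f.1.1 (0, x)) = toOp x
    rw [h, polarPart_of_mem_unitary x.1.2]
  · refine Subtype.ext (Subtype.ext ?_)
    have h : f.1.1 (1, x) = 1 := congrArg (fun h => h.1 x) hf₁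
    change polarPart (f.1.1 (1, x)) = 1
    rw [h, polarPart_of_mem_unitary (one_mem _)]
  · exact Subtype.ext (Subtype.ext (hequiv g t x))
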